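/- Let $k$ be a field and let $A$ be an Azumaya algebra (central simple algebra) of degree $n\ge 1$ over $k$, i.e. a $k$-algebra such that $A\otimes_k k_s\simeq M_n(k_s)$ for a separable closure $k_s$ of $k$. For integers $1\le i_1<\dots<i_r\le n$ let $\mathrm{Flag}(i_1,\dots,i_r;A)$ be the $k$-scheme representing the functor that sends a $k$-algebra $R$ to the set of chains $I_1\subset\dots\subset I_r$ of left ideals of $A\otimes_k R$ such that $(A\otimes_k R)/I_j$ is a locally free $R$-module of rank $n^2-n\,i_j$ for every $j$, and put $\mathrm{SB}_i(A)=\mathrm{Flag}(i;A)$. More generally, for an Azumaya algebra $\mathcal B$ of degree $m$ on a scheme $S$ (a quasi-coherent $\mathcal O_S$-algebra which is, locally for the étale topology, isomorphic to $M_m(\mathcal O_S)$; $m=0$, i.e. $\mathcal B=0$, is allowed), and integers $1\le a_1<\dots<a_t\le m$ with $t\ge 0$, let $\mathrm{Flag}(a_1,\dots,a_t;\mathcal B)\to S$ be the $S$-scheme whose $R$-points above a point $x\in S(R)$ are the chains $J_1\subset\dots\subset J_t$ of left ideals of the $R$-algebra $\mathcal B_x=x^*\mathcal B$ such that $\mathcal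 B_x/J_j$ is locally free of rank $m^2-m\,a_j$ for every $j$; it is $S$ itself when $t=0$. Let $1\le i_1<\dots<i_r\le n$ be integers, fix $s\in\{1,\dots,r\}$ and put $S=\mathrm{SB}_{i_s}(A)$. Let $\mathcal I\subset A\otimes_k\mathcal O_S$ be the universal left ideal, $\mathcal I^\circ=\{a:\mathcal I a=0\}$ its right annihilator, and $\mathcal I^\circ\mathcal I$ the submodule generated by the products of a section of $\mathcal I^\circ$ and a section of $\mathcal I$. Then, with the multiplication induced by that of $A\otimes_k\mathcal O_S$, $$\mathcal B_-=\mathcal I/\mathcal I^\circ\mathcal I\qquad\text{and}\qquad \mathcal B_+=\mathcal I^\circ/\mathcal I^\circ\mathcal I$$ are Azumaya algebras on $S$ of degrees $i_s$ and $n-i_s$ respectively, and there is an isomorphism $$\mathrm{Flag}(i_1,\dots,i_r;A)\;\simeq\;\mathrm{Flag}(i_1,\dots,i_{s-1};\mathcal B_-)\times_S\mathrm{Flag}(i_{s+1}-i_s,\dots,i_r-i_s;\mathcal B_+)$$ of schemes over $S$, where the left-hand side is viewed over $S$ by the projection $(I_1,\dots,I_r)\mapsto I_s$. -/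

import Mathlib

open CategoryTheory CategoryTheory.Limits AlgebraicGeometry TensorProduct

universe u v w

noncomputable section

namespace TwistedFlag

/-! ### Base change of algebras and locally free modules -/

section BaseChange

variable {R R' : Type u} [CommRing R] [CommRing R'] {B B' : Type u} [Ring B] [Ring B']
  [Algebra R B] [Algebra R' B']

/-- A ring homomorphism `φ : B → B'` over `f : R → R'` exhibits the `R'`-algebra `B'` as the base
change of the `R`-algebra `B`, i.e. it induces an isomorphism `R' ⊗[R] B ≅ B'`. -/
structure IsAlgBaseChange (f : R →+* R') (φ : B →+* B') : Prop where
  map_algebraMap : ∀ r, φ (algebraMap R B r) = algebraMap R' B' (f r)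
  isBaseChange :
    letI := f.toAlgebra
    letI := Algebra.compHom B' f
    haveI : IsScalarTower R R' B' := IsScalarTower.of_algebraMap_eq' rfl
    IsBaseChange R' ({ φ with commutes' := map_algebraMap } : B →ₐ[R] B').toLinearMap

theorem IsAlgBaseChange.of_equiv {f : R →+* R'} {φ : B →+* B'}
    (h : ∀ r, φ (algebraMap R B r) = algebraMap R' B' (f r))
    (e : letI := f.toAlgebra; R' ⊗[R] B ≃ₗ[R'] B')
    (he : letI := f.toAlgebra; ∀ b : B, e (1 ⊗ₜ b) = φ b) : IsAlgBaseChange f φ := by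
  refine ⟨h, ?_⟩
  let := f.toAlgebra
  let := Algebra.compHom B' f
  have : IsScalarTower R R' B' := IsScalarTower.of_algebraMap_eq' rfl
  exact IsBaseChange.of_equiv e he

/-- The `R`-module `M` is locally free of (finite, constant) rank `d`: it is finitely generated
projective and its rank at every prime of `R` is `d`. -/
def IsLocallyFreeOfRank (R : Type u) [CommRing R] (M : Type u) [AddCommGroup M] [Module R M]
    (d : ℕ) : Prop :=
  Module.Finite R M ∧ Module.Projective R M ∧ ∀ p, Module.rankAtStalk (R := R) M p = d

theorem IsAlgBaseChange.isLocallyFreeOfRank {f : R →+* R'} {φ : B →+* B'}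
    (h : IsAlgBaseChange f φ) (J : Ideal B) (d : ℕ) (hJ : IsLocallyFreeOfRank R (B ⧸ J) d) :
    IsLocallyFreeOfRank R' (B' ⧸ J.map φ) d := by
  let := f.toAlgebra
  let := Algebra.compHom B' f
  have : IsScalarTower R R' B' := IsScalarTower.of_algebraMap_eq' rfl
  have hb := h.isBaseChange
  set ψ : B →ₐ[R] B' := { φ with commutes' := h.map_algebraMap } with hψ
  have hψφ : ∀ b, ψ b = φ b := fun _ => rfl
  let J' : Ideal B' := J.map φ
  let f₁ : (J.restrictScalars R) →ₗ[R] B := (J.restrictScalars R).subtype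
  let g₁ : B →ₗ[R] B ⧸ J := (J.mkQ).restrictScalars R
  let f₂ : R' ⊗[R] (J.restrictScalars R) →ₗ[R'] B' :=
    (TensorProduct.isBaseChange R (J.restrictScalars R) R').lift (ψ.toLinearMap ∘ₗ f₁)
  let g₂ : B' →ₗ[R'] B' ⧸ J' := (J'.mkQ).restrictScalars R'
  have hle : J.restrictScalars R ≤ LinearMap.ker ((g₂.restrictScalars R) ∘ₗ ψ.toLinearMap) := by
    intro b hb
    exact (Submodule.Quotient.mk_eq_zero J').2 (Ideal.mem_map_of_mem φ hb)
  let h₃ : B ⧸ J →ₗ[R] B' ⧸ J' :=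
    (Submodule.liftQ (J.restrictScalars R) _ hle) ∘ₗ
      (Submodule.Quotient.restrictScalarsEquiv R J).symm.toLinearMap
  have hrange : ∀ x, f₂ x ∈ J' := by
    intro x
    induction x using TensorProduct.induction_on with
    | zero => simp
    | add x y hx hy => rw [map_add]; exact J'.add_mem hx hy
    | tmul r b =>
      have h1 : f₂ (r ⊗ₜ b) = algebraMap R' B' r * φ b := by
        have h2 : r ⊗ₜ[R] b = r • (1 ⊗ₜ[R] b) := by simp [TensorProduct.smul_tmul']
        rw [h2, map_smul, Algebra.smul_def]
        congr 1
        exact (TensorProduct.isBaseChange R (J.restrictScalars R) R').lift_eq _ b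
      rw [h1]
      exact J'.mul_mem_left _ (Ideal.mem_map_of_mem φ b.2)
  have hmem : ∀ y ∈ J', ∃ x, f₂ x = y := by
    intro y hy
    refine Submodule.span_induction ?_ ?_ ?_ ?_ hy
    · rintro _ ⟨b, hb, rfl⟩
      exact ⟨1 ⊗ₜ ⟨b, hb⟩,
        (TensorProduct.isBaseChange R (J.restrictScalars R) R').lift_eq _ ⟨b, hb⟩⟩
    · exact ⟨0, map_zero _⟩
    · rintro _ _ _ _ ⟨a, rfl⟩ ⟨b, rfl⟩
      exact ⟨a + b, map_add _ _ _⟩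
    · rintro c _ hm ⟨x, rfl⟩
      clear hm
      induction c using hb.inductionOn with
      | zero => exact ⟨0, by simp⟩
      | add c₁ c₂ h₁ h₂ =>
        obtain ⟨a, ha⟩ := h₁
        obtain ⟨b, hb⟩ := h₂
        exact ⟨a + b, by rw [map_add, ha, hb, add_smul]⟩
      | smul r c h₁ =>
        obtain ⟨a, ha⟩ := h₁
        exact ⟨r • a, by rw [map_smul, ha, smul_assoc]⟩
      | tmul c =>
        induction x using TensorProduct.induction_on with
        | zero => exact ⟨0, by simp⟩
        | add x y hx hy =>
          obtain ⟨a, ha⟩ := hx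
          obtain ⟨b, hb⟩ := hy
          exact ⟨a + b, by rw [map_add, ha, hb, map_add, smul_add]⟩
        | tmul r b =>
          refine ⟨r ⊗ₜ ⟨c * b, J.mul_mem_left _ b.2⟩, ?_⟩
          have h1 : ∀ b : J.restrictScalars R, f₂ (r ⊗ₜ b) = algebraMap R' B' r * φ b := by
            intro b
            have h2 : r ⊗ₜ[R] b = r • (1 ⊗ₜ[R] b) := by simp [TensorProduct.smul_tmul']
            rw [h2, map_smul, Algebra.smul_def]
            congr 1
            exact (TensorProduct.isBaseChange R (J.restrictScalars R) R').lift_eq _ b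
          rw [h1, h1, smul_eq_mul, AlgHom.toLinearMap_apply, hψφ, map_mul, ← mul_assoc,
            ← mul_assoc, Algebra.commutes]
  have hb₃ : IsBaseChange R' h₃ := by
    refine IsBaseChange.of_right_exact R' (TensorProduct.mk R R' (J.restrictScalars R) 1)
      ψ.toLinearMap h₃ (f := f₁) (g := g₁) (f' := f₂) (g' := g₂) ?_ ?_
      (TensorProduct.isBaseChange R (J.restrictScalars R) R') hb ?_ ?_ ?_ ?_
    · ext b
      exact ((TensorProduct.isBaseChange R (J.restrictScalars R) R').lift_eq _ b).symm
    · ext b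
      rfl
    · intro b
      constructor
      · intro hb
        exact ⟨⟨b, (Submodule.Quotient.mk_eq_zero J).1 hb⟩, rfl⟩
      · rintro ⟨b, rfl⟩
        exact (Submodule.Quotient.mk_eq_zero J).2 b.2
    · exact J.mkQ_surjective
    · intro b
      constructor
      · intro hb
        exact hmem b ((Submodule.Quotient.mk_eq_zero J').1 hb)
      · rintro ⟨b, rfl⟩
        exact (Submodule.Quotient.mk_eq_zero J').2 (hrange b)
    · exact J'.mkQ_surjective
  obtain ⟨hfin, hproj, hrk⟩ := hJ
  refine ⟨Module.Finite.equiv hb₃.equiv, Module.Projective.of_equiv hb₃.equiv, fun p => ?_⟩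
  exact (Module.rankAtStalk_isBaseChange hb₃ p).trans (hrk _)

end BaseChange

/-! ### Quasi-coherent algebras and their flag functors

Schemes are studied through their points with values in rings. A category `C` of "test objects"
with a functor `O` to commutative rings is given. In the first instance `C` consists of the
`k`-algebras `R`, and stands for `Spec k`; in the second one it consists of the pairs `(R, x)` of
a `k`-algebra `R` and an `R`-point `x` of a `k`-scheme `S`, and stands for `S`. -/

section QCohAlg

variable {C : Type w} [Category.{v} C]

/-- A quasi-coherent sheaf of (associative, unital) algebras, given by its values: an `O(c)`-algebra
for every test object `c`, together with transition maps that are compatible with composition and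
identify the value at `d` with the base change of the value at `c` for every `c ⟶ d`. -/
structure QCohAlg (O : C ⥤ CommRingCat.{u}) where
  obj : C → Type u
  [ring : ∀ c, Ring (obj c)]
  [algebra : ∀ c, Algebra (O.obj c) (obj c)]
  map : ∀ {c d : C}, (c ⟶ d) → (obj c →+* obj d)
  map_id : ∀ (c : C) (b : obj c), map (𝟙 c) b = b
  map_comp : ∀ {c d e : C} (f : c ⟶ d) (g : d ⟶ e) (b : obj c), map (f ≫ g) b = map g (map f b)
  isAlgBaseChange : ∀ {c d : C} (f : c ⟶ d), IsAlgBaseChange (O.map f).hom (map f)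

attribute [instance] QCohAlg.ring QCohAlg.algebra

variable {O : C ⥤ CommRingCat.{u}}

/-- `B` is an Azumaya algebra of degree `m`: locally for the étale topology it is isomorphic to the
algebra of `m × m` matrices over the structure sheaf. -/
def QCohAlg.IsAzumaya (B : QCohAlg O) (m : ℕ) : Prop :=
  ∀ c : C, ∃ (R' : Type u) (_ : CommRing R') (_ : Algebra (O.obj c) R'),
    Algebra.Etale (O.obj c) R' ∧ Module.FaithfullyFlat (O.obj c) R' ∧
      Nonempty (R' ⊗[O.obj c] B.obj c ≃ₐ[R'] Matrix (Fin m) (Fin m) R')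

/-- For an `R`-algebra `B` (Azumaya of degree `m`) and a family of integers `i j`, the set of
increasing families of left ideals `I j` of `B` such that `B / I j` is locally free of rank
`m² - m i j` over `R`. -/
def FlagSet (R : Type u) [CommRing R] (B : Type u) [Ring B] [Algebra R B] (m : ℕ)
    {ι : Type} [Preorder ι] (i : ι → ℕ) : Type u :=
  { I : ι → Ideal B // Monotone I ∧ ∀ j, IsLocallyFreeOfRank R (B ⧸ I j) (m ^ 2 - m * i j) }

/-- The functor of flags of left ideals in the algebra `B` (Azumaya of degree `m`); on transition
maps a left ideal `I` is sent to the left ideal generated by its image, i.e. to its base change. -/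
def flagFunctor (B : QCohAlg O) (m : ℕ) {ι : Type} [Preorder ι] (i : ι → ℕ) : C ⥤ Type u where
  obj c := FlagSet (O.obj c) (B.obj c) m i
  map f := ↾fun I => ⟨fun j => (I.1 j).map (B.map f), fun _ _ h => Ideal.map_mono (I.2.1 h),
    fun j => (B.isAlgBaseChange f).isLocallyFreeOfRank _ _ (I.2.2 j)⟩
  map_id c := by
    have h : B.map (𝟙 c) = RingHom.id _ := RingHom.ext (B.map_id c)
    ext I
    refine Subtype.ext (funext fun j => ?_)
    change (I.1 j).map (B.map (𝟙 c)) = I.1 j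
    rw [h, Ideal.map_id]
  map_comp f g := by
    have h : B.map (f ≫ g) = (B.map g).comp (B.map f) := RingHom.ext (B.map_comp f g)
    ext I
    refine Subtype.ext (funext fun j => ?_)
    change (I.1 j).map (B.map (f ≫ g)) = ((I.1 j).map (B.map f)).map (B.map g)
    rw [h, Ideal.map_map]

/-- Pullback along a functor of test objects. -/
def QCohAlg.pullback {D : Type*} [Category* D] (F : D ⥤ C) (B : QCohAlg O) : QCohAlg (F ⋙ O) where
  obj d := B.obj (F.obj d)
  ring d := B.ring (F.obj d)
  algebra d := B.algebra (F.obj d)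
  map f := B.map (F.map f)
  map_id d b := by rw [F.map_id, B.map_id]
  map_comp f g b := by rw [F.map_comp, B.map_comp]
  isAlgBaseChange f := B.isAlgBaseChange (F.map f)

/-- The algebra `B` is the quotient `M / N`, where `M` is a family of non-unital subalgebras and `N`
a family of submodules of the algebra `E`: there are surjective multiplicative linear
maps `M c → B c` with kernel `M c ∩ N c`, compatible with base change. (This determines the
multiplication of `B`, and hence its unit.) -/
def QCohAlg.IsSubquotient (B E : QCohAlg O) (M : ∀ c, NonUnitalSubalgebra (O.obj c) (E.obj c))
    (N : ∀ c, Submodule (O.obj c) (E.obj c)) : Prop :=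
  ∃ q : ∀ c, M c →ₙₐ[O.obj c] B.obj c,
    (∀ c, Function.Surjective (q c)) ∧
    (∀ c (a : M c), q c a = 0 ↔ (a : E.obj c) ∈ N c) ∧
    ∀ {c d : C} (f : c ⟶ d) (a : M c),
      ∃ b : M d, (b : E.obj d) = E.map f a ∧ q d b = B.map f (q c a)

end QCohAlg

/-! ### Central simple algebras over a field and their flag functors -/

section Field

variable (k : Type u) [Field k] (A : Type u) [Ring A] [Algebra k A]

/-- `A` is an Azumaya algebra (central simple algebra) of degree `n` over the field `k`:
over a separable closure of `k` it becomes isomorphic to the algebra of `n × n` matrices. -/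
def IsAzumayaOfDegree (n : ℕ) : Prop :=
  1 ≤ n ∧ Nonempty (SeparableClosure k ⊗[k] A ≃ₐ[SeparableClosure k]
    Matrix (Fin n) (Fin n) (SeparableClosure k))

theorem isAlgBaseChange_tensor {R R' : Type u} [CommRing R] [CommRing R'] [Algebra k R]
    [Algebra k R'] (f : R →ₐ[k] R') :
    IsAlgBaseChange (B := R ⊗[k] A) (B' := R' ⊗[k] A) f.toRingHom
      (Algebra.TensorProduct.map f (AlgHom.id k A)).toRingHom := by
  let : Algebra R R' := f.toRingHom.toAlgebra
  have : IsScalarTower k R R' := IsScalarTower.of_algebraMap_eq' f.comp_algebraMap.symm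
  refine IsAlgBaseChange.of_equiv (fun r => ?_)
    (TensorProduct.AlgebraTensorModule.cancelBaseChange k R R' R' A) fun x => ?_
  · change Algebra.TensorProduct.map f (AlgHom.id k A) (r ⊗ₜ 1) = f r ⊗ₜ 1
    simp
  · induction x using TensorProduct.induction_on with
    | zero => simp
    | add x y hx hy => rw [TensorProduct.tmul_add, map_add, map_add, hx, hy]
    | tmul r a =>
      rw [TensorProduct.AlgebraTensorModule.cancelBaseChange_tmul, Algebra.smul_def, mul_one]
      rfl

/-- The algebra `R ↦ R ⊗[k] A` on `k`-algebras. -/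
def constAlg : QCohAlg (forget₂ (CommAlgCat.{u} k) CommRingCat.{u}) where
  obj R := R ⊗[k] A
  ring R := inferInstanceAs (Ring (R ⊗[k] A))
  algebra R := inferInstanceAs (Algebra R (R ⊗[k] A))
  map f := (Algebra.TensorProduct.map f.hom (AlgHom.id k A)).toRingHom
  map_id R b := by
    change Algebra.TensorProduct.map (AlgHom.id k R) (AlgHom.id k A) b = b
    simp
  map_comp {R₁ R₂ R₃} f g b := by
    change Algebra.TensorProduct.map (g.hom.comp f.hom) ((AlgHom.id k A).comp (AlgHom.id k A)) b =
      Algebra.TensorProduct.map g.hom (AlgHom.id k A)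
        (Algebra.TensorProduct.map f.hom (AlgHom.id k A) b)
    rw [Algebra.TensorProduct.map_comp]
    rfl
  isAlgBaseChange {R R'} f := isAlgBaseChange_tensor k A f.hom

/-- The functor on `k`-algebras `R ↦ {I_1 ⊆ … ⊆ I_r left ideals of R ⊗[k] A such that the quotient
by I_j is locally free of rank n² - n i_j}`. -/
abbrev flagFunctorOver (n : ℕ) {ι : Type} [Preorder ι] (i : ι → ℕ) : CommAlgCat.{u} k ⥤ Type u :=
  flagFunctor (constAlg k A) n i

end Field

/-! ### Annihilators and subquotient algebras -/

section Annihilator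

variable (R : Type u) [CommRing R] {B : Type u} [Ring B] [Algebra R B]

/-- A left ideal, as a non-unital subalgebra. -/
def idealAlg (I : Ideal B) : NonUnitalSubalgebra R B where
  carrier := I
  add_mem' := I.add_mem
  zero_mem' := I.zero_mem
  mul_mem' _ hb := I.mul_mem_left _ hb
  smul_mem' r _ hb := (I.restrictScalars R).smul_mem r hb

/-- The right annihilator `I° = {a | I a = 0}` of a left ideal, as a non-unital subalgebra. -/
def annAlg (I : Ideal B) : NonUnitalSubalgebra R B where
  carrier := {a | ∀ y ∈ I, y * a = 0}
  add_mem' ha hb y hy := by rw [mul_add, ha y hy, hb y hy, add_zero]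
  zero_mem' y _ := mul_zero y
  mul_mem' ha _ y hy := by rw [← mul_assoc, ha y hy, zero_mul]
  smul_mem' r _ ha y hy := by rw [mul_smul_comm, ha y hy, smul_zero]

/-- The product `I° I`, i.e. the additive span of the products `a * y`, `a ∈ I°`, `y ∈ I`. -/
def annMul (I : Ideal B) : Submodule R B :=
  (annAlg R I).toSubmodule * (idealAlg R I).toSubmodule

end Annihilator

/-! ### Schemes -/

section Scheme

variable {k : Type u} [Field k]

/-- The functor of points of a `k`-scheme `X` on `k`-algebras, `R ↦ Hom_k(Spec R, X)`. -/
def points (X : Over (Spec (.of k))) : CommAlgCat.{u} k ⥤ Type u :=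
  (algSpec (.of k)).rightOp ⋙ yoneda.obj X

/-- The structure ring `(R, x) ↦ R` on the category of pairs of a `k`-algebra `R` and a point
`x ∈ S(R)`. -/
abbrev structureRing (S : Over (Spec (.of k))) : (points S).Elements ⥤ CommRingCat.{u} :=
  CategoryOfElements.π (points S) ⋙ forget₂ (CommAlgCat.{u} k) CommRingCat.{u}

/-- The relative functor of points of an `S`-scheme `g : Y ⟶ S`: to an `R`-point `x` of `S` it
attaches the set of `R`-points of `Y` above `x`. -/
def relPoints {Y S : Over (Spec (.of k))} (g : Y ⟶ S) : (points S).Elements ⥤ Type u where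
  obj x := { y : (points Y).obj x.1 // y ≫ g = x.2 }
  map {x x'} f := ↾fun y => ⟨(points Y).map f.1 y.1, by
    refine Eq.trans ?_ f.2
    refine (Category.assoc ((algSpec (.of k)).map f.1.op) y.1 g).trans ?_
    exact congrArg (fun z => (algSpec (.of k)).map f.1.op ≫ z) y.2⟩
  map_id x := by
    ext y
    exact ConcreteCategory.congr_hom ((points Y).map_id x.1) y.1
  map_comp f g := by
    ext y
    exact ConcreteCategory.congr_hom ((points Y).map_comp f.1 g.1) y.1

/-- The `k`-scheme `X` represents the functor `F` on `k`-algebras. -/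
abbrev Represents (X : Over (Spec (.of k))) (F : CommAlgCat.{u} k ⥤ Type u) : Type (u + 1) :=
  points X ≅ F

/-- The `S`-scheme `g : Y ⟶ S` represents the functor `F` on points of `S`. -/
abbrev RepresentsOver {Y S : Over (Spec (.of k))} (g : Y ⟶ S)
    (F : (points S).Elements ⥤ Type u) : Type (u + 1) :=
  relPoints g ≅ F

variable {A : Type u} [Ring A] [Algebra k A]

variable (A) in
/-- The algebra `A ⊗ O_S` on the `k`-scheme `S`, with value `R ⊗[k] A` at a point `x ∈ S(R)`. -/
abbrev constAlgOn (S : Over (Spec (.of k))) : QCohAlg (structureRing S) :=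
  (constAlg k A).pullback (CategoryOfElements.π (points S))

/-- If `S` represents the functor of left ideals `I` of `R ⊗[k] A` with quotient locally free of
rank `n² - n d` (i.e. `S` is the generalized Severi-Brauer scheme), the universal left ideal of
`A ⊗ O_S`; its value at a point `x ∈ S(R)` is the left ideal of `R ⊗[k] A` corresponding to `x`. -/
def univIdeal {S : Over (Spec (.of k))} {n d : ℕ}
    (e : Represents S (flagFunctorOver k A n fun _ : Unit => d)) (x : (points S).Elements) :
    Ideal ((constAlgOn A S).obj x) :=
  (e.hom.app x.1 x.2).1 ()

end Scheme

end TwistedFlag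

end

open TwistedFlag

noncomputable section

namespace TwistedFlag

/-! ### Schemes over a field and their points in algebras -/

section FunctorOfPoints

variable {k : Type u} [Field k]

/-! Everything is checked on points with values in `k`-algebras `R`. Write `B = R ⊗ A` and let `I`
be the left ideal of `B` given by an `R`-point of `S`. Because `A` is separable, an `R`-linear
section of `B → B / I` can be averaged to a `B`-linear one, so `I = B e` for an idempotent `e`
(`IsAzumayaOfDegree.exists_idempotent`). Then `I° = (1 - e) B` and `I° I = (1 - e) B e`, so the two
subquotients are the corners `e B e` and `(1 - e) B (1 - e)`.

Étale locally `B` is a matrix algebra and `e = Q P` with `P Q = 1` of size `d = i_s`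
(`IsAzumayaOfDegree.isSplitIdempotent`). This makes the corner a matrix algebra of size `d`, it
makes `e` full when `d ≥ 1`, and it gives `n * rank (e M) = d * rank M` for `B`-modules `M`. By
Morita theory left ideals inside `B e` correspond to left ideals of `e B e`, and left ideals
containing `B e` to those of `(1 - e) B (1 - e)`; the rank formula matches the rank conditions.
Hence flags with `s`-th step `B e` are pairs of flags in the corners
(`FlagIdempotent.restrict_bijective`).

The idempotent is chosen separately at every point and is not preserved by base change `φ`; only the
left ideal is. But `φ e` and the chosen `e'` generate the same left ideal, so `x ↦ e' φ(x) e'` is a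
canonical transition map between corners, and the bijection on flags is natural for it
(`restrict_map`). Since affine schemes cover all schemes, a natural bijection of points over `S` is
an isomorphism over `S` (`exists_iso_pullback`). -/

/-- A scheme over `Spec K` has an affine open cover, and the structure morphism makes the ring of
each member a `K`-algebra. -/
theorem algSpec_isCoverDense (K : CommRingCat.{u}) :
    (algSpec K).IsCoverDense (Scheme.zariskiTopology.over (Spec K)) where
  is_cover X := by
    rw [GrothendieckTopology.mem_over_iff]
    refine GrothendieckTopology.superset_covering _ ?_
      X.left.affineCover.mem_grothendieckTopology
    rw [Sieve.ofArrows, Sieve.generate_le_iff]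
    rintro _ _ ⟨i⟩
    rw [Sieve.overEquiv_iff]
    let R : CommRingCat := X.left.affineOpenCover.X i
    let g : Spec R ⟶ Spec K := X.left.affineCover.f i ≫ X.hom
    let φ : K ⟶ R := Spec.preimage g
    let : Algebra K R := φ.hom.toAlgebra
    let e : Over.mk (X.left.affineCover.f i ≫ X.hom) ≅ (algSpec K).obj (.op (.of K R)) :=
      Over.isoMk (Iso.refl _) ((Category.id_comp _).trans (Spec.map_preimage g))
    refine ⟨⟨.op (.of K R), e.hom, e.inv ≫ Over.homMk (X.left.affineCover.f i) rfl, ?_⟩⟩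
    simp

/-- A morphism of `k`-schemes is determined by its effect on points with values in `k`-algebras. -/
theorem points_hom_ext {X Y : Over (Spec (.of k))} {f g : X ⟶ Y}
    (h : ∀ (R : CommAlgCat.{u} k) (x : (points X).obj R), x ≫ f = x ≫ g) : f = g :=
  have := algSpec_isCoverDense (.of k)
  Functor.IsCoverDense.ext (algSpec (.of k))
    (ℱ := (Scheme.zariskiTopology.over (Spec (.of k))).yoneda.obj Y) X
    (s := f) (t := g) fun R x => h R.unop x

/-- Every natural transformation between functors of points comes from a morphism of schemes. -/
theorem exists_hom_of_points {X Y : Over (Spec (.of k))} (α : points X ⟶ points Y) :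
    ∃ f : X ⟶ Y, ∀ (R : CommAlgCat.{u} k) (x : (points X).obj R), x ≫ f = α.app R x := by
  have := algSpec_isCoverDense (.of k)
  have : (algSpec (.of k)).Full := algSpec.instFull
  -- This is `α` reindexed by the double opposite. Since `Hom(-, Y)` is a Zariski sheaf, `β` extends
  -- to all schemes, and the desired morphism is the image of `𝟙 X`.
  let β : (algSpec (.of k)).op ⋙ yoneda.obj X ⟶
      (algSpec (.of k)).op ⋙
        ((Scheme.zariskiTopology.over (Spec (.of k))).yoneda.obj Y).obj :=
    { app := fun R => α.app R.unop.unop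
      naturality := fun R R' f => α.naturality f.unop.unop }
  exact ⟨Functor.IsCoverDense.Types.appHom β X (𝟙 X), fun R x =>
    (Functor.IsCoverDense.Types.appHom_restrict β (Y := .op R) x.op (𝟙 X)).trans
      (congrArg (α.app R) (Category.comp_id x))⟩

/-- Natural transformations of functors of points which are inverse to each other come from
an isomorphism of schemes. -/
theorem exists_iso_of_points {X Y : Over (Spec (.of k))} (α : points X ≅ points Y) :
    ∃ f : X ≅ Y, ∀ (R : CommAlgCat.{u} k) (x : (points X).obj R), x ≫ f.hom = α.hom.app R x := by
  obtain ⟨f, hf⟩ := exists_hom_of_points α.hom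
  obtain ⟨g, hg⟩ := exists_hom_of_points α.inv
  refine ⟨⟨f, g, points_hom_ext fun R x => ?_, points_hom_ext fun R x => ?_⟩, hf⟩
  · exact (Category.assoc (obj := Over (Spec (.of k))) x f g).symm.trans <| (hg R (x ≫ f)).trans <|
      (congrArg (α.inv.app R) (hf R x)).trans
      ((Iso.hom_inv_id_apply (α.app R) x).trans
        (Category.comp_id (obj := Over (Spec (.of k))) x).symm)
  · exact (Category.assoc (obj := Over (Spec (.of k))) x g f).symm.trans <| (hf R (x ≫ g)).trans <|
      (congrArg (α.hom.app R) (hg R x)).trans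
      ((Iso.inv_hom_id_apply (α.app R) x).trans
        (Category.comp_id (obj := Over (Spec (.of k))) x).symm)

theorem points_map_comp {X S : Over (Spec (.of k))} (p : X ⟶ S) {R R' : CommAlgCat.{u} k}
    (f : R ⟶ R') (y : (points X).obj R) :
    ((points X).map f y ≫ p : (points S).obj R') = (points S).map f (y ≫ p) :=
  Category.assoc (obj := Over (Spec (.of k))) ((algSpec (.of k)).map f.op) y p

/-- If the `S`-scheme `X` has the same relative functor of points as the fibre product of the
`S`-schemes `Y` and `Z`, it is isomorphic to that fibre product over `S`. -/
theorem exists_iso_pullback {X Y Z S : Over (Spec (.of k))} (p : X ⟶ S) (g : Y ⟶ S) (h : Z ⟶ S)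
    (T : ∀ x, (relPoints p).obj x ≃ (relPoints g).obj x × (relPoints h).obj x)
    (hT : ∀ {x x' : (points S).Elements} (f : x ⟶ x') (y : (relPoints p).obj x),
      T x' ((relPoints p).map f y) =
        ((relPoints g).map f (T x y).1, (relPoints h).map f (T x y).2)) :
    ∃ φ : X ≅ pullback g h, φ.hom ≫ pullback.fst g h ≫ g = p := by
  let t : ∀ (R : CommAlgCat.{u} k) (y : (points X).obj R),
      (relPoints g).obj ⟨R, y ≫ p⟩ × (relPoints h).obj ⟨R, y ≫ p⟩ := fun R y =>
    T ⟨R, y ≫ p⟩ ⟨y, rfl⟩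
  let a : ∀ (R : CommAlgCat.{u} k), (points X).obj R → (points (pullback g h)).obj R :=
    fun R y => pullback.lift (C := Over (Spec (.of k))) (t R y).1.1 (t R y).2.1
      ((t R y).1.2.trans (t R y).2.2.symm)
  have ha₁ : ∀ R y, (a R y ≫ pullback.fst g h : (points Y).obj R) = (t R y).1.1 := fun R y =>
    pullback.lift_fst (C := Over (Spec (.of k))) _ _ _
  have ha₂ : ∀ R y, (a R y ≫ pullback.snd g h : (points Z).obj R) = (t R y).2.1 := fun R y =>
    pullback.lift_snd (C := Over (Spec (.of k))) _ _ _
  have hext : ∀ (R : CommAlgCat.{u} k) (u v : (points (pullback g h)).obj R),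
      (u ≫ pullback.fst g h : (points Y).obj R) = v ≫ pullback.fst g h →
      (u ≫ pullback.snd g h : (points Z).obj R) = v ≫ pullback.snd g h → u = v :=
    fun R u v h₁ h₂ => pullback.hom_ext (C := Over (Spec (.of k))) h₁ h₂
  -- The type of `T` depends on the base point, so a propositional equality `y ≫ p = x` has to be
  -- transported before values can be compared.
  have htransport : ∀ (R : CommAlgCat.{u} k) (x : (points S).obj R) (y : (points X).obj R)
      (hy : y ≫ p = x), (T ⟨R, x⟩ ⟨y, hy⟩).1.1 = (t R y).1.1 ∧
        (T ⟨R, x⟩ ⟨y, hy⟩).2.1 = (t R y).2.1 := by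
    rintro R _ y rfl
    exact ⟨rfl, rfl⟩
  have hap : ∀ R y, (a R y ≫ pullback.fst g h ≫ g : (points S).obj R) = y ≫ p := fun R y =>
    (Category.assoc (obj := Over (Spec (.of k))) _ _ _).symm.trans
      ((congrArg (fun z : (points Y).obj R => (z ≫ g : (points S).obj R)) (ha₁ R y)).trans
        (t R y).1.2)
  have hnat : ∀ {R R' : CommAlgCat.{u} k} (f : R ⟶ R') (y : (points X).obj R),
      a R' ((points X).map f y) = (points (pullback g h)).map f (a R y) := by
    intro R R' f y
    let c : (points S).Elements := ⟨R, y ≫ p⟩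
    let c' : (points S).Elements := ⟨R', (points X).map f y ≫ p⟩
    let F : c ⟶ c' := CategoryOfElements.homMk c c' f (points_map_comp p f y).symm
    have hF : t R' ((points X).map f y) =
        ((relPoints g).map F (t R y).1, (relPoints h).map F (t R y).2) := hT F ⟨y, rfl⟩
    refine hext R' _ _ ?_ ?_
    · refine (ha₁ _ _).trans ((congrArg (fun z => z.1.1) hF).trans ?_)
      refine Eq.trans ?_ (points_map_comp (pullback.fst g h) f (a R y)).symm
      exact congrArg ((points _).map f) (ha₁ R y).symm
    · refine (ha₂ _ _).trans ((congrArg (fun z => z.2.1) hF).trans ?_)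
      refine Eq.trans ?_ (points_map_comp (pullback.snd g h) f (a R y)).symm
      exact congrArg ((points _).map f) (ha₂ R y).symm
  have hbij : ∀ R, Function.Bijective (a R) := by
    intro R
    constructor
    · intro y y' hyy
      -- Points with the same image lie over the same point of `S`, where injectivity of `T`
      -- applies.
      have hp : (y ≫ p : (points S).obj R) = y' ≫ p := by rw [← hap, ← hap, hyy]
      have h₁ : (⟨y, hp⟩ : (relPoints p).obj ⟨R, y' ≫ p⟩) = ⟨y', rfl⟩ := by
        refine (T _).injective (Prod.ext (Subtype.ext ?_) (Subtype.ext ?_))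
        · rw [(htransport R _ y hp).1, ← ha₁, hyy, ha₁]
        · rw [(htransport R _ y hp).2, ← ha₂, hyy, ha₂]
      exact congrArg Subtype.val h₁
    · intro z
      have hz : (z ≫ pullback.snd g h) ≫ h = (z ≫ pullback.fst g h) ≫ g := by
        refine (Category.assoc (obj := Over (Spec (.of k))) _ _ _).trans ?_
        refine Eq.trans ?_ (Category.assoc (obj := Over (Spec (.of k))) _ _ _).symm
        exact congrArg (fun w => z ≫ w) pullback.condition.symm
      obtain ⟨⟨y, hy⟩, hyz⟩ := (T ⟨R, (z ≫ pullback.fst g h) ≫ g⟩).surjective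
        (⟨z ≫ pullback.fst g h, rfl⟩, ⟨z ≫ pullback.snd g h, hz⟩)
      refine ⟨y, hext R _ _ ?_ ?_⟩
      · rw [ha₁, ← (htransport R _ y hy).1, hyz]
      · rw [ha₂, ← (htransport R _ y hy).2, hyz]
  obtain ⟨φ, hφ⟩ := exists_iso_of_points (X := X) (Y := pullback g h)
    (NatIso.ofComponents (fun R => (Equiv.ofBijective (a R) (hbij R)).toIso) (by
      intro R R' f
      ext y
      exact hnat f y))
  refine ⟨φ, points_hom_ext fun R x => ?_⟩
  exact (Category.assoc (obj := Over (Spec (.of k))) x φ.hom _).symm.trans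
    ((congrArg (fun z : (points (pullback g h)).obj R =>
      (z ≫ pullback.fst g h ≫ g : (points S).obj R)) (hφ R x)).trans (hap R x))

end FunctorOfPoints

/-! ### Corner algebras -/

section Corner

variable {R : Type u} [CommRing R] {B : Type u} [Ring B] [Algebra R B] {e : B}
  (he : IsIdempotentElem e)

theorem corner_left (x : he.Corner) : e * x.1 = x.1 :=
  ((Subsemigroup.mem_corner_iff he).1 x.2).1

theorem corner_right (x : he.Corner) : x.1 * e = x.1 :=
  ((Subsemigroup.mem_corner_iff he).1 x.2).2

/-- The element `e b e` of the corner. -/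
def cornerMk (b : B) : he.Corner := ⟨e * b * e, b, rfl⟩

@[simp] theorem cornerMk_val (b : B) : (cornerMk he b).1 = e * b * e := rfl

@[simp] theorem corner_mul_val (x y : he.Corner) : (x * y).1 = x.1 * y.1 := rfl

@[simp] theorem corner_add_val (x y : he.Corner) : (x + y).1 = x.1 + y.1 := rfl

@[simp] theorem corner_zero_val : (0 : he.Corner).1 = 0 := rfl

@[simp] theorem corner_one_val : (1 : he.Corner).1 = e := rfl

theorem cornerMk_val_self (x : he.Corner) : cornerMk he x.1 = x :=
  Subtype.ext (by rw [cornerMk_val, corner_left, corner_right])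

instance cornerAlgebra : Algebra R he.Corner where
  smul r x := ⟨r • x.1, r • x.1, by simp [corner_left he x, corner_right he x]⟩
  algebraMap :=
    { toFun := fun r => ⟨r • e, r • e, by simp [he.eq]⟩
      map_one' := Subtype.ext (one_smul R e)
      map_zero' := Subtype.ext (zero_smul R e)
      map_add' := fun r s => Subtype.ext (add_smul r s e)
      map_mul' := fun r s => Subtype.ext (by
        change (r * s) • e = (r • e) * (s • e)
        rw [smul_mul_smul_comm, he.eq]) }
  commutes' r x := Subtype.ext (by
    change (r • e) * x.1 = x.1 * (r • e)
    rw [smul_mul_assoc, mul_smul_comm, corner_left, corner_right])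
  smul_def' r x := Subtype.ext (by
    change r • x.1 = (r • e) * x.1
    rw [smul_mul_assoc, corner_left])

@[simp] theorem corner_smul_val (r : R) (x : he.Corner) : (r • x).1 = r • x.1 := rfl

@[simp] theorem corner_algebraMap_val (r : R) : (algebraMap R he.Corner r).1 = r • e := rfl

variable (R) in
/-- The inclusion of the corner in the algebra. -/
def cornerVal : he.Corner →ₗ[R] B where
  toFun := Subtype.val
  map_add' _ _ := rfl
  map_smul' _ _ := rfl

variable (R) in
/-- The projection `b ↦ e b e` onto the corner. -/
def cornerProj : B →ₗ[R] he.Corner where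
  toFun := cornerMk he
  map_add' a b := Subtype.ext (by simp [mul_add, add_mul])
  map_smul' r a := Subtype.ext (by simp)

end Corner

/-! ### Base change of corners -/

section CornerBaseChange

variable {R R' : Type u} [CommRing R] [CommRing R'] [Algebra R R']
  {B B' C : Type u} [Ring B] [Ring B'] [Algebra R B] [Algebra R' B'] [Algebra R B']
  [IsScalarTower R R' B'] [AddCommGroup C] [Module R' C] [Module R C] [IsScalarTower R R' C]
  {e : B} (he : IsIdempotentElem e)

/-- A linear map on the corner `e B e` is a base change as soon as it is, compatibly with the
projection of `B` on the corner, a retract of a base change of `B`. -/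
theorem isBaseChange_corner {φ : B →ₗ[R] B'} (hφ : IsBaseChange R' φ) (ψ : he.Corner →ₗ[R] C)
    (p : B' →ₗ[R'] C) (i : C →ₗ[R'] B') (hi : ∀ x, i (ψ x) = φ x.1)
    (hp : ∀ b, p (φ b) = ψ (cornerMk he b)) (hpi : ∀ c, p (i c) = c) : IsBaseChange R' ψ := by
  let T : R' ⊗[R] he.Corner →ₗ[R'] C := (TensorProduct.isBaseChange R he.Corner R').lift ψ
  -- The inverse of `T`: embed `C` in `B'`, identify `B'` with `R' ⊗ B`, then project to the corner.
  let U : C →ₗ[R'] R' ⊗[R] he.Corner :=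
    (cornerProj R he).baseChange R' ∘ₗ hφ.equiv.symm.toLinearMap ∘ₗ i
  have hT : ∀ x, T (1 ⊗ₜ x) = ψ x := fun x =>
    (TensorProduct.isBaseChange R he.Corner R').lift_eq ψ x
  have hTp : T ∘ₗ (cornerProj R he).baseChange R' = p ∘ₗ hφ.equiv.toLinearMap := by
    ext b
    simp only [AlgebraTensorModule.curry_apply, curry_apply,
      LinearMap.comp_apply, LinearMap.baseChange_tmul, LinearEquiv.coe_coe, hφ.equiv_tmul,
      one_smul, hp, LinearMap.coe_restrictScalars]
    exact hT _
  refine IsBaseChange.of_equiv (LinearEquiv.ofLinearMap T U ?_ ?_) hT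
  · ext c
    have := LinearMap.congr_fun hTp (hφ.equiv.symm (i c))
    simp only [LinearMap.comp_apply, LinearEquiv.coe_coe, LinearEquiv.apply_symm_apply, hpi] at this
    exact this
  · ext x
    simp only [AlgebraTensorModule.curry_apply, curry_apply,
      LinearMap.comp_apply, LinearMap.coe_restrictScalars, LinearMap.id_apply, U, hT, hi,
      LinearEquiv.coe_coe, hφ.equiv_symm_apply, LinearMap.baseChange_tmul]
    exact congrArg (fun y => (1 : R') ⊗ₜ[R] y) (cornerMk_val_self he x)

end CornerBaseChange

section CornerMap

variable {R R' : Type u} [CommRing R] [CommRing R'] {B B' : Type u} [Ring B] [Ring B']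
  [Algebra R B] [Algebra R' B'] {e : B} (he : IsIdempotentElem e) {e' : B'}
  (he' : IsIdempotentElem e')

/-- Two idempotents are equivalent in the sense needed to compare their corners by `x ↦ e x e`. -/
structure CornerCompatible (a b : B) : Prop where
  left : a * b * a = a
  right : b * a * b = b

/-- The map `x ↦ e' φ(x) e'` between corners. -/
def cornerMap (φ : B →+* B') (h : CornerCompatible (φ e) e') : he.Corner →+* he'.Corner where
  toFun x := cornerMk he' (φ x.1)
  map_one' := Subtype.ext h.right
  map_zero' := Subtype.ext (by simp)
  map_add' x y := Subtype.ext (by simp [mul_add, add_mul])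
  map_mul' x y := Subtype.ext (by
    change e' * φ (x.1 * y.1) * e' = (e' * φ x.1 * e') * (e' * φ y.1 * e')
    -- Since `φ x` ends and `φ y` begins with `φ e`, the factor between them can be replaced by `φ e
    -- * e' * φ e`.
    have hx : φ x.1 = φ x.1 * φ e := by rw [← map_mul, corner_right]
    have hy : φ y.1 = φ e * φ y.1 := by rw [← map_mul, corner_left]
    calc e' * φ (x.1 * y.1) * e' = e' * (φ x.1 * φ e) * φ y.1 * e' := by
          rw [← hx, map_mul, ← mul_assoc e']
      _ = e' * (φ x.1 * (φ e * e' * φ e)) * φ y.1 * e' := by rw [h.left]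
      _ = e' * (φ x.1 * φ e) * (e' * e') * (φ e * φ y.1) * e' := by
          rw [he'.eq]; simp only [mul_assoc]
      _ = (e' * φ x.1 * e') * (e' * φ y.1 * e') := by
          rw [← hx, ← hy]; simp only [mul_assoc])

@[simp] theorem cornerMap_val (φ : B →+* B') (h : CornerCompatible (φ e) e') (x : he.Corner) :
    (cornerMap he he' φ h x).1 = e' * φ x.1 * e' := rfl

/-- The base change of `e B e` is `φ(e) B' φ(e)`, and compatibility makes `x ↦ e' x e'` and `y ↦
φ(e) y φ(e)` inverse bijections between this corner and `e' B' e'`. -/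
theorem IsAlgBaseChange.corner {f : R →+* R'} {φ : B →+* B'} (hφ : IsAlgBaseChange f φ)
    (h : CornerCompatible (φ e) e') : IsAlgBaseChange f (cornerMap he he' φ h) := by
  have hsmul : ∀ (r : R) (b : B), φ (r • b) = f r • φ b := fun r b => by
    rw [Algebra.smul_def, map_mul, hφ.map_algebraMap, ← Algebra.smul_def]
  refine ⟨fun r => Subtype.ext ?_, ?_⟩
  · rw [cornerMap_val, corner_algebraMap_val, corner_algebraMap_val, hsmul, mul_smul_comm,
      smul_mul_assoc, h.right]
  · let := f.toAlgebra
    let := Algebra.compHom B' f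
    have : IsScalarTower R R' B' := IsScalarTower.of_algebraMap_eq' rfl
    let := Algebra.compHom he'.Corner f
    have : IsScalarTower R R' he'.Corner := IsScalarTower.of_algebraMap_eq' rfl
    refine isBaseChange_corner he hφ.isBaseChange _
      (p := cornerProj R' he' ∘ₗ LinearMap.mulLeft R' (φ e) ∘ₗ LinearMap.mulRight R' (φ e))
      (i := LinearMap.mulLeft R' (φ e) ∘ₗ LinearMap.mulRight R' (φ e) ∘ₗ cornerVal R' he')
      (fun x => ?_) (fun b => Subtype.ext ?_) (fun c => Subtype.ext ?_)
    · change φ e * (e' * φ x.1 * e' * φ e) = φ x.1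
      have hx : φ x.1 = φ e * φ x.1 * φ e := by
        rw [← map_mul, ← map_mul, corner_left, corner_right]
      calc φ e * (e' * φ x.1 * e' * φ e)
          = (φ e * e' * φ e) * φ x.1 * (φ e * e' * φ e) := by
            conv_lhs => rw [hx]
            simp only [mul_assoc]
        _ = φ x.1 := by rw [h.left, ← hx]
    · change e' * (φ e * (φ b * φ e)) * e' = e' * φ (e * b * e) * e'
      rw [map_mul, map_mul, mul_assoc (φ e)]
    · change e' * (φ e * (φ e * (c.1 * φ e) * φ e)) * e' = c.1
      have hee : φ e * φ e = φ e := by rw [← map_mul, he.eq]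
      have hc : c.1 = e' * c.1 * e' := by rw [corner_left, corner_right]
      calc e' * (φ e * (φ e * (c.1 * φ e) * φ e)) * e'
          = e' * (φ e * φ e) * c.1 * (φ e * φ e) * e' := by simp only [mul_assoc]
        _ = (e' * φ e * e') * c.1 * (e' * φ e * e') := by
            rw [hee]
            conv_lhs => rw [hc]
            simp only [mul_assoc]
        _ = c.1 := by rw [h.right, ← hc]

end CornerMap

section CornerAlg

variable {C : Type w} [Category.{v} C] {O : C ⥤ CommRingCat.{u}}

/-- The quasi-coherent algebra of corners defined by a compatible family of idempotents. -/
def cornerAlg (E : QCohAlg O) (e : ∀ c, E.obj c) (he : ∀ c, IsIdempotentElem (e c))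
    (h : ∀ {c d} (f : c ⟶ d), CornerCompatible (E.map f (e c)) (e d))
    (hcomp : ∀ {c d d'} (f : c ⟶ d) (g : d ⟶ d'),
      E.map (f ≫ g) (e c) * E.map g (e d) * e d' = E.map (f ≫ g) (e c) * e d' ∧
      e d' * E.map g (e d) * E.map (f ≫ g) (e c) = e d' * E.map (f ≫ g) (e c)) : QCohAlg O where
  obj c := (he c).Corner
  ring c := inferInstance
  algebra c := cornerAlgebra (he c)
  map f := cornerMap (he _) (he _) (E.map f) (h f)
  map_id c b := Subtype.ext (by
    rw [cornerMap_val, E.map_id, corner_left, corner_right])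
  map_comp {c d d'} f g b := Subtype.ext (by
    obtain ⟨h₁, h₂⟩ := hcomp f g
    simp only [cornerMap_val, map_mul, ← E.map_comp]
    have hb : E.map (f ≫ g) b.1 = E.map (f ≫ g) (e c) * E.map (f ≫ g) b.1 * E.map (f ≫ g) (e c) := by
      rw [← map_mul, ← map_mul, corner_left, corner_right]
    rw [hb]
    -- The two sides differ by the factors `E.map g (e d)` coming from the intermediate object;
    -- `hcomp` absorbs them.
    calc e d' * (E.map (f ≫ g) (e c) * E.map (f ≫ g) b.1 * E.map (f ≫ g) (e c)) * e d'
        = (e d' * E.map (f ≫ g) (e c)) * E.map (f ≫ g) b.1 * (E.map (f ≫ g) (e c) * e d') := by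
          simp only [mul_assoc]
      _ = _ := by
          rw [← h₁, ← h₂]
          simp only [mul_assoc])
  isAlgBaseChange f := (E.isAlgBaseChange f).corner (he _) (he _) (h f)

end CornerAlg

/-! ### Idempotents of constant rank -/

section BaseChangeEquiv

variable {R R' B B' : Type u} [CommRing R] [CommRing R'] [Algebra R R'] [Ring B] [Ring B']
  [Algebra R B] [Algebra R' B'] [Algebra R B'] [IsScalarTower R R' B']

/-- The isomorphism of algebras `R' ⊗[R] B ≃ B'` given by a base change. -/
def algEquivOfIsBaseChange (ψ : B →ₐ[R] B') (h : IsBaseChange R' ψ.toLinearMap) :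
    R' ⊗[R] B ≃ₐ[R'] B' :=
  Algebra.TensorProduct.algEquivOfLinearEquivTensorProduct h.equiv
    (fun r s a b => by simp [h.equiv_tmul, smul_smul, mul_comm])
    (by simp [h.equiv_tmul])

theorem algEquivOfIsBaseChange_symm_apply (ψ : B →ₐ[R] B') (h : IsBaseChange R' ψ.toLinearMap)
    (b : B) : (algEquivOfIsBaseChange ψ h).symm (ψ b) = 1 ⊗ₜ b :=
  h.equiv_symm_apply b

/-- The base change of the action of an algebra on a module. -/
def baseChangeAction (ψ : B →ₐ[R] B') (h : IsBaseChange R' ψ.toLinearMap) (M : Type u)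
    [AddCommGroup M] [Module R M] [Module B M] [IsScalarTower R B M] :
    B' →ₐ[R'] Module.End R' (R' ⊗[R] M) :=
  ((LinearMap.tensorProductEnd R R' M).comp
    (Algebra.TensorProduct.map (AlgHom.id R' R') (Algebra.lsmul R R M))).comp
      (algEquivOfIsBaseChange ψ h).symm.toAlgHom

theorem baseChangeAction_apply (ψ : B →ₐ[R] B') (h : IsBaseChange R' ψ.toLinearMap) (M : Type u)
    [AddCommGroup M] [Module R M] [Module B M] [IsScalarTower R B M] (b : B) :
    baseChangeAction ψ h M (ψ b) = (Algebra.lsmul R R M b).baseChange R' := by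
  have : baseChangeAction ψ h M (ψ b) = (LinearMap.tensorProductEnd R R' M)
      (Algebra.TensorProduct.map (AlgHom.id R' R') (Algebra.lsmul R R M)
        ((algEquivOfIsBaseChange ψ h).symm (ψ b))) := rfl
  rw [this, algEquivOfIsBaseChange_symm_apply, Algebra.TensorProduct.map_tmul]
  exact (one_smul R' _ : (1 : R') • (Algebra.lsmul R R M b).baseChange R' = _)

end BaseChangeEquiv

/-! ### Morita equivalence for an idempotent matrix -/

section MatrixAction

variable {R : Type u} [CommRing R] {n d : ℕ} {M N : Type u} [AddCommGroup M] [AddCommGroup N]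
  [Module R M] [Module R N]

/-- If `e = Q P` with `P Q = 1`, of size `d`, is an idempotent matrix of size `n`, then for a module
`M` over the algebra of matrices, `(e M) ^ n` is isomorphic to `M ^ d`. -/
theorem nonempty_linearEquiv_of_matrix (ρ : Matrix (Fin n) (Fin n) R →ₐ[R] Module.End R M)
    (P : Matrix (Fin d) (Fin n) R) (Q : Matrix (Fin n) (Fin d) R) (hPQ : P * Q = 1)
    (i : N →ₗ[R] M) (p : M →ₗ[R] N) (hpi : p ∘ₗ i = LinearMap.id) (hip : i ∘ₗ p = ρ (Q * P)) :
    Nonempty ((Fin n → N) ≃ₗ[R] (Fin d → M)) := by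
  -- `U` and `V` are an `n × d` and a `d × n` array of elements of the matrix algebra. Their
  -- products are the identity arrays with diagonal entries `Q P` and `1` respectively, so they give
  -- inverse maps between `(e M) ^ n` and `M ^ d`.
  let U : Fin n → Fin d → Matrix (Fin n) (Fin n) R := fun a b => Q * Matrix.single b a (1 : R)
  let V : Fin d → Fin n → Matrix (Fin n) (Fin n) R := fun b a => Matrix.single a b (1 : R) * P
  have hUV : ∀ a a', ∑ b, U a b * V b a' = if a = a' then Q * P else 0 := by
    intro a a'
    have h1 : ∀ b, U a b * V b a' =
        Q * ((Matrix.single b a (1 : R) * Matrix.single a' b (1 : R)) * P) := fun b => by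
      simp only [U, V, Matrix.mul_assoc]
    simp only [h1]
    rw [← Matrix.mul_sum, ← Matrix.sum_mul]
    split_ifs with h
    · subst h
      simp only [Matrix.single_mul_single_same, mul_one]
      rw [Matrix.sum_single_one, Matrix.one_mul]
    · simp [Matrix.single_mul_single_of_ne _ _ _ _ h]
  have hVU : ∀ b b', ∑ a, V b a * U a b' = if b = b' then 1 else 0 := by
    intro b b'
    have h1 : ∀ a, V b a * U a b' = 
        Matrix.single a b (1 : R) * (1 : Matrix (Fin d) (Fin d) R) * Matrix.single b' a (1 : R) := fun a => by
      rw [← hPQ]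
      simp only [U, V, Matrix.mul_assoc]
    simp only [h1, Matrix.mul_one]
    split_ifs with h
    · subst h
      simp only [Matrix.single_mul_single_same, mul_one]
      rw [Matrix.sum_single_one]
    · simp [Matrix.single_mul_single_of_ne _ _ _ _ h]
  have heU : ∀ a b, Q * P * U a b = U a b := fun a b => by
    simp only [U]
    rw [Matrix.mul_assoc, ← Matrix.mul_assoc P, hPQ, Matrix.one_mul]
  let F : (Fin n → N) →ₗ[R] (Fin d → M) :=
    LinearMap.pi fun b => ∑ a, ρ (V b a) ∘ₗ i ∘ₗ LinearMap.proj a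
  let G : (Fin d → M) →ₗ[R] (Fin n → N) :=
    LinearMap.pi fun a => ∑ b, p ∘ₗ ρ (U a b) ∘ₗ LinearMap.proj b
  have hip' : ∀ m, i (p m) = ρ (Q * P) m := fun m => LinearMap.congr_fun hip m
  have hpi' : ∀ m, p (i m) = m := fun m => LinearMap.congr_fun hpi m
  refine ⟨LinearEquiv.ofLinearMap F G ?_ ?_⟩
  · refine LinearMap.ext fun x => funext fun b => ?_
    have h1 : ∀ a b', ρ (V b a) (i (p (ρ (U a b') (x b')))) = ρ (V b a * U a b') (x b') := by
      intro a b'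
      rw [hip', ← Module.End.mul_apply (ρ (Q * P)), ← map_mul, heU, map_mul, Module.End.mul_apply]
    simp only [F, G, LinearMap.comp_apply, LinearMap.pi_apply, LinearMap.sum_apply,
      LinearMap.proj_apply, map_sum, h1, LinearMap.id_apply]
    rw [Finset.sum_comm]
    have h2 : ∀ b', ∑ a, ρ (V b a * U a b') (x b') = if b = b' then x b' else 0 := by
      intro b'
      rw [← LinearMap.sum_apply, ← map_sum, hVU]
      split_ifs <;> simp
    simp only [h2, Finset.sum_ite_eq, Finset.mem_univ, if_true]
  · refine LinearMap.ext fun x => funext fun a => ?_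
    simp only [F, G, LinearMap.comp_apply, LinearMap.pi_apply, LinearMap.sum_apply,
      LinearMap.proj_apply, map_sum, LinearMap.id_apply]
    rw [Finset.sum_comm]
    have h2 : ∀ a', ∑ b, p (ρ (U a b) (ρ (V b a') (i (x a')))) = if a = a' then x a' else 0 := by
      intro a'
      simp only [← Module.End.mul_apply, ← map_mul]
      rw [← map_sum, ← LinearMap.sum_apply, ← map_sum, hUV]
      split_ifs
      · rw [← hip', hpi', hpi']
      · simp
    simp [h2]

end MatrixAction

/-! ### Étale-locally split idempotents -/

section Split

variable (R : Type u) [CommRing R] {B : Type u} [Ring B] [Algebra R B]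

/-- The element `e` of the `R`-algebra `B` becomes, locally for the étale topology, an idempotent
matrix of rank `d` in an algebra of matrices of size `n`. -/
def IsSplitIdempotent (n d : ℕ) (e : B) : Prop :=
  ∃ (R' : Type u) (_ : CommRing R') (_ : Algebra R R'),
    Algebra.Etale R R' ∧ Module.FaithfullyFlat R R' ∧
      ∃ ψ : B →ₐ[R] Matrix (Fin n) (Fin n) R', IsBaseChange R' ψ.toLinearMap ∧
        ∃ (P : Matrix (Fin d) (Fin n) R') (Q : Matrix (Fin n) (Fin d) R'),
          P * Q = 1 ∧ Q * P = ψ e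

variable {R} {n d : ℕ} {e : B}

/-- The map `X ↦ P X Q` identifies the corner of `Q P` in the `n × n` matrices with the `d × d`
matrices, with inverse `X ↦ Q X P`. -/
theorem IsSplitIdempotent.exists_corner_algEquiv (h : IsSplitIdempotent R n d e)
    (he : IsIdempotentElem e) :
    ∃ (R' : Type u) (_ : CommRing R') (_ : Algebra R R'),
      Algebra.Etale R R' ∧ Module.FaithfullyFlat R R' ∧
        Nonempty (R' ⊗[R] he.Corner ≃ₐ[R'] Matrix (Fin d) (Fin d) R') := by
  obtain ⟨R', _, _, hR₁, hR₂, ψ, hψ, P, Q, hPQ, hQP⟩ := h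
  have hx₁ : ∀ x : he.Corner, Q * P * ψ x.1 = ψ x.1 := fun x => by
    rw [hQP, ← map_mul, corner_left]
  have hx₂ : ∀ x : he.Corner, ψ x.1 * (Q * P) = ψ x.1 := fun x => by
    rw [hQP, ← map_mul, corner_right]
  let χ : he.Corner →ₐ[R] Matrix (Fin d) (Fin d) R' :=
    AlgHom.ofLinearMap
      { toFun := fun x => P * ψ x.1 * Q
        map_add' := fun x y => by simp [Matrix.mul_add, Matrix.add_mul]
        map_smul' := fun r x => by simp }
      (by
        change P * ψ e * Q = 1
        rw [← hQP, ← Matrix.mul_assoc P, hPQ, Matrix.one_mul, hPQ])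
      (fun x y => by
        change P * ψ (x.1 * y.1) * Q = P * ψ x.1 * Q * (P * ψ y.1 * Q)
        have : P * ψ x.1 * Q * (P * ψ y.1 * Q) = P * (ψ x.1 * (Q * P) * ψ y.1) * Q := by
          simp only [Matrix.mul_assoc]
        rw [this, hx₂, map_mul])
  have hχ : IsBaseChange R' χ.toLinearMap := by
    refine isBaseChange_corner he hψ _
      (p := { toFun := fun X => P * X * Q
              map_add' := fun x y => by simp [Matrix.mul_add, Matrix.add_mul]
              map_smul' := fun r x => by simp })
      (i := { toFun := fun X => Q * X * P
              map_add' := fun x y => by simp [Matrix.mul_add, Matrix.add_mul]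
              map_smul' := fun r x => by simp }) (fun x => ?_) (fun b => ?_) (fun c => ?_)
    · change Q * (P * ψ x.1 * Q) * P = ψ x.1
      have : Q * (P * ψ x.1 * Q) * P = Q * P * ψ x.1 * (Q * P) := by simp only [Matrix.mul_assoc]
      rw [this, hx₁, hx₂]
    · change P * ψ b * Q = P * ψ (e * b * e) * Q
      rw [map_mul, map_mul, ← hQP]
      have : P * (Q * P * ψ b * (Q * P)) * Q = P * Q * P * ψ b * Q * (P * Q) := by
        simp only [Matrix.mul_assoc]
      rw [this, hPQ, Matrix.one_mul, Matrix.mul_one]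
    · change P * (Q * c * P) * Q = c
      have : P * (Q * c * P) * Q = P * Q * c * (P * Q) := by simp only [Matrix.mul_assoc]
      rw [this, hPQ, Matrix.one_mul, Matrix.mul_one]
  exact ⟨R', _, _, hR₁, hR₂, ⟨algEquivOfIsBaseChange χ hχ⟩⟩

theorem rankAtStalk_fin_fun {R : Type u} [CommRing R] {M : Type u} [AddCommGroup M] [Module R M]
    [Module.Finite R M] [Module.Flat R M] (m : ℕ) (p : PrimeSpectrum R) :
    Module.rankAtStalk (Fin m → M) p = m * Module.rankAtStalk M p := by
  rw [Module.rankAtStalk_pi, finsum_eq_sum_of_fintype]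
  simp

/-- For a split idempotent `e` of rank `d` in an algebra of degree `n` and a module `M`, the rank
of `e M` is `d / n` times the rank of `M`. -/
theorem IsSplitIdempotent.mul_rankAtStalk (h : IsSplitIdempotent R n d e)
    {M N : Type u} [AddCommGroup M] [AddCommGroup N] [Module R M] [Module R N] [Module B M]
    [IsScalarTower R B M] [Module.Finite R M] [Module.Projective R M] [Module.Finite R N]
    [Module.Projective R N] (i : N →ₗ[R] M) (q : M →ₗ[R] N)
    (hqi : ∀ x, q (i x) = x) (hiq : ∀ m, i (q m) = e • m) (p : PrimeSpectrum R) :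
    n * Module.rankAtStalk N p = d * Module.rankAtStalk M p := by
  obtain ⟨R', _, _, hR₁, hR₂, ψ, hψ, P, Q, hPQ, hQP⟩ := h
  -- Every prime lifts to the faithfully flat cover and ranks are unchanged there, so it suffices to
  -- compare ranks over `R'`.
  obtain ⟨p', rfl⟩ := PrimeSpectrum.comap_surjective_of_faithfullyFlat (A := R) (B := R') p
  rw [← Module.rankAtStalk_baseChange, ← Module.rankAtStalk_baseChange, ← rankAtStalk_fin_fun,
    ← rankAtStalk_fin_fun]
  obtain ⟨E⟩ := nonempty_linearEquiv_of_matrix (baseChangeAction ψ hψ M) P Q hPQ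
    (i.baseChange R') (q.baseChange R')
    (by
      rw [← LinearMap.baseChange_comp, show q ∘ₗ i = LinearMap.id from LinearMap.ext hqi,
        LinearMap.baseChange_id])
    (by
      rw [hQP, baseChangeAction_apply, ← LinearMap.baseChange_comp]
      congr 1
      exact LinearMap.ext hiq)
  exact congrFun (Module.rankAtStalk_eq_of_equiv E) p'

/-- A split idempotent of positive rank generates the unit ideal. -/
theorem IsSplitIdempotent.exists_sum_eq_one (h : IsSplitIdempotent R n d e) (hd : 1 ≤ d) :
    ∃ (m : ℕ) (x y : Fin m → B), ∑ t, x t * e * y t = 1 := by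
  obtain ⟨R', _, _, hR₁, hR₂, ψ, hψ, P, Q, hPQ, hQP⟩ := h
  -- `T` is the two-sided ideal generated by `e`. By faithfully flat descent `B / T` vanishes as
  -- soon as `R' ⊗ (B / T)` does.
  let T : Submodule R B := Submodule.span R (Set.range fun z : B × B => z.1 * e * z.2)
  suffices hT : (1 : B) ∈ T by
    obtain ⟨c, hc⟩ := (Finsupp.mem_span_range_iff_exists_finsupp (R := R)).1 hT
    let E : c.support ≃ Fin c.support.card := c.support.equivFin
    refine ⟨c.support.card, fun t => c (E.symm t).1 • (E.symm t).1.1,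
      fun t => (E.symm t).1.2, ?_⟩
    rw [← hc, Finsupp.sum, ← Finset.sum_coe_sort c.support]
    refine Fintype.sum_equiv E.symm _ (fun z : c.support => c z.1 • (z.1.1 * e * z.1.2)) fun t => ?_
    simp only [smul_mul_assoc]
  let g : Matrix (Fin n) (Fin n) R' →ₗ[R'] R' ⊗[R] (B ⧸ T) :=
    T.mkQ.baseChange R' ∘ₗ hψ.equiv.symm.toLinearMap
  have hg : ∀ b, g (ψ b) = 1 ⊗ₜ T.mkQ b := fun b => by
    have := hψ.equiv_symm_apply b
    simp only [AlgHom.toLinearMap_apply] at this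
    simp [g, this]
  have hg₀ : ∀ X Y, g (X * ψ e * Y) = 0 := by
    intro X Y
    induction X using hψ.inductionOn with
    | zero => simp
    | add X₁ X₂ h₁ h₂ => rw [add_mul, add_mul, map_add, h₁, h₂, add_zero]
    | smul r X h => rw [smul_mul_assoc, smul_mul_assoc, map_smul, h, smul_zero]
    | tmul x =>
      induction Y using hψ.inductionOn with
      | zero => simp
      | add X₁ X₂ h₁ h₂ => rw [mul_add, map_add, h₁, h₂, add_zero]
      | smul r X h => rw [mul_smul_comm, map_smul, h, smul_zero]
      | tmul y =>
        have : T.mkQ (x * e * y) = 0 :=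
          (Submodule.Quotient.mk_eq_zero T).2 (Submodule.subset_span ⟨(x, y), rfl⟩)
        rw [AlgHom.toLinearMap_apply, AlgHom.toLinearMap_apply, ← map_mul, ← map_mul, hg, this,
          tmul_zero]
  have hg₁ : ∀ Z, g Z = 0 := by
    intro Z
    let b : Fin d := ⟨0, hd⟩
    -- From `P Q = 1`, each term collapses to `Z` times the diagonal matrix unit at `a`. The fixed
    -- index `b` exists because `d ≥ 1`.
    have : Z = ∑ a, Z * (Matrix.single a b (1 : R') * P) * ψ e * (Q * Matrix.single b a (1 : R')) := by
      have h1 : ∀ a, Z * (Matrix.single a b (1 : R') * P) * ψ e * (Q * Matrix.single b a (1 : R')) =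
          Z * Matrix.single a a 1 := by
        intro a
        rw [← hQP]
        have : Z * (Matrix.single a b (1 : R') * P) * (Q * P) * (Q * Matrix.single b a (1 : R')) =
            Z * (Matrix.single a b (1 : R') * (P * Q) * (P * Q) * Matrix.single b a (1 : R')) := by
          simp only [Matrix.mul_assoc]
        rw [this, hPQ, Matrix.mul_one, Matrix.mul_one, Matrix.single_mul_single_same, mul_one]
      simp only [h1]
      rw [← Matrix.mul_sum, Matrix.sum_single_one, Matrix.mul_one]
    rw [this, map_sum]
    exact Finset.sum_eq_zero fun a _ => hg₀ _ _
  have : Subsingleton (R' ⊗[R] (B ⧸ T)) := by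
    have hsurj : Function.Surjective g := by
      have h₁ : Function.Surjective (T.mkQ.baseChange R') :=
        LinearMap.lTensor_surjective R' T.mkQ_surjective
      exact h₁.comp hψ.equiv.symm.surjective
    refine ⟨fun a b => ?_⟩
    obtain ⟨a, rfl⟩ := hsurj a
    obtain ⟨b, rfl⟩ := hsurj b
    rw [hg₁, hg₁]
  have := Module.FaithfullyFlat.lTensor_reflects_triviality R R' (B ⧸ T)
  exact (Submodule.Quotient.mk_eq_zero T).1 (Subsingleton.elim _ _)

end Split

/-! ### Splitting by an étale extension -/

section MatrixBaseChange

/-- `IsAlgBaseChange` uses algebra structures built from `f`. Taking the given structures as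
variables with equations allows them to be substituted. -/
theorem isAlgBaseChange_of_eq {R R' B B' : Type u} [CommRing R] [CommRing R'] [Ring B] [Ring B']
    [Algebra R B] [Algebra R' B'] (f : R →+* R') (i₁ : Algebra R R') (h₁ : i₁ = f.toAlgebra)
    (i₂ : Algebra R B') (h₂ : i₂ = Algebra.compHom B' f) (i₃ : IsScalarTower R R' B')
    (ψ : B →ₐ[R] B') (h : IsBaseChange R' ψ.toLinearMap) : IsAlgBaseChange f ψ.toRingHom := by
  subst h₁ h₂
  let := f.toAlgebra
  let := Algebra.compHom B' f
  exact ⟨ψ.commutes, h⟩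

theorem isAlgBaseChange_algebraMap {R R' B B' : Type u} [CommRing R] [CommRing R'] [Ring B]
    [Ring B'] [Algebra R B] [Algebra R' B'] [i₁ : Algebra R R'] [i₂ : Algebra R B']
    [i₃ : IsScalarTower R R' B']
    (ψ : B →ₐ[R] B') (h : IsBaseChange R' ψ.toLinearMap) :
    IsAlgBaseChange (algebraMap R R') ψ.toRingHom :=
  isAlgBaseChange_of_eq _ i₁ (Algebra.algebra_ext _ _ fun _ => rfl) i₂
    (Algebra.algebra_ext _ _ fun r => IsScalarTower.algebraMap_apply R R' B' r) i₃ ψ h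

theorem isBaseChange_mapMatrix {L R' : Type u} [CommRing L] [CommRing R'] [Algebra L R'] (n : ℕ) :
    IsBaseChange R' ((Algebra.ofId L R').mapMatrix (m := Fin n)).toLinearMap := by
  have h := ((IsBaseChange.linearMap L R').finitePow (Fin n)).finitePow (Fin n)
  exact h

end MatrixBaseChange

/-! ### Splitting by a finite separable extension -/

section Field

variable {k : Type u} [Field k] {A : Type u} [Ring A] [Algebra k A] {n : ℕ}

theorem finrank_of_splitting {Ω : Type u} [Field Ω] [Algebra k Ω]
    (E : Ω ⊗[k] A ≃ₐ[Ω] Matrix (Fin n) (Fin n) Ω) : Module.finrank k A = n ^ 2 := by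
  rw [← Module.finrank_baseChange (R := Ω), E.toLinearEquiv.finrank_eq, Module.finrank_matrix]
  simp [sq]

theorem finite_of_splitting {Ω : Type u} [Field Ω] [Algebra k Ω]
    (E : Ω ⊗[k] A ≃ₐ[Ω] Matrix (Fin n) (Fin n) Ω) (hn : 1 ≤ n) : Module.Finite k A := by
  refine Module.finite_of_finrank_pos ?_
  rw [finrank_of_splitting E]
  positivity

/-- An algebra split by a separable extension is split by a finite separable extension. -/
theorem exists_finite_splitting {Ω : Type u} [Field Ω] [Algebra k Ω] [Algebra.IsSeparable k Ω]
    (E : Ω ⊗[k] A ≃ₐ[Ω] Matrix (Fin n) (Fin n) Ω) (hn : 1 ≤ n) :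
    ∃ (L : Type u) (_ : Field L) (_ : Algebra k L), Algebra.Etale k L ∧
      ∃ θ : A →ₐ[k] Matrix (Fin n) (Fin n) L, IsBaseChange L θ.toLinearMap := by
  have := finite_of_splitting E hn
  have hrank := finrank_of_splitting E
  let b := Module.finBasis k A
  let F : A →ₐ[k] Matrix (Fin n) (Fin n) (Ω) :=
    (E.toAlgHom.restrictScalars k).comp Algebra.TensorProduct.includeRight
  -- The finitely many matrix entries of the images of a basis generate a field over which the
  -- splitting is already defined.
  let s : Set (Ω) := Set.range fun z : Fin _ × Fin n × Fin n => F (b z.1) z.2.1 z.2.2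
  let L : IntermediateField k (Ω) := IntermediateField.adjoin k s
  have hL : FiniteDimensional k L :=
    IntermediateField.finiteDimensional_adjoin fun x _ => Algebra.IsIntegral.isIntegral x
  have : Algebra.IsSeparable k L := Algebra.isSeparable_tower_bot_of_isSeparable k L (Ω)
  have : Algebra.FormallyEtale k L := Algebra.FormallyEtale.of_isSeparable k L
  have : Algebra.FinitePresentation k L := Algebra.FinitePresentation.of_finiteType.1 inferInstance
  let ι : Matrix (Fin n) (Fin n) L →ₐ[k] Matrix (Fin n) (Fin n) (Ω) :=
    L.val.mapMatrix
  have hι : Function.Injective ι := Matrix.map_injective (f := L.val) L.val.injective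
  have hF : ∀ a, F a ∈ ι.range := by
    have h1 : LinearMap.range F.toLinearMap ≤ Subalgebra.toSubmodule ι.range := by
      rw [LinearMap.range_eq_map, ← b.span_eq, Submodule.map_span, Submodule.span_le]
      rintro _ ⟨_, ⟨z, rfl⟩, rfl⟩
      refine ⟨Matrix.of fun i j => ⟨F (b z) i j,
        IntermediateField.subset_adjoin k s ⟨(z, i, j), rfl⟩⟩, ?_⟩
      ext i j
      rfl
    exact fun a => h1 ⟨a, rfl⟩
  let θ : A →ₐ[k] Matrix (Fin n) (Fin n) L :=
    (AlgEquiv.ofInjective ι hι).symm.toAlgHom.comp (F.codRestrict ι.range hF)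
  have hθ : ∀ a, ι (θ a) = F a := fun a => by
    have := (AlgEquiv.ofInjective ι hι).apply_symm_apply (F.codRestrict ι.range hF a)
    exact congrArg Subtype.val this
  refine ⟨L, inferInstance, inferInstance, ⟨inferInstance, inferInstance⟩, θ, ?_⟩
  let T : L ⊗[k] A →ₗ[L] Matrix (Fin n) (Fin n) L :=
    (TensorProduct.isBaseChange k A L).lift θ.toLinearMap
  have hT : ∀ a, T (1 ⊗ₜ a) = θ a := fun a => (TensorProduct.isBaseChange k A L).lift_eq _ a
  -- Inside the matrices over `Ω`, `T` is the restriction of the isomorphism `E`. It is therefore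
  -- injective, and bijective because both sides have dimension `n ^ 2` over `L`.
  have hTι : ∀ x, ι (T x) = E (LinearMap.rTensor A L.val.toLinearMap x) := by
    intro x
    induction x using TensorProduct.induction_on with
    | zero => simp
    | add x y hx hy => simp only [map_add, hx, hy]
    | tmul l a =>
      have h1 : l ⊗ₜ[k] a = l • (1 ⊗ₜ[k] a) := by simp [TensorProduct.smul_tmul']
      have h2 : LinearMap.rTensor A L.val.toLinearMap (l ⊗ₜ a) =
          (L.val l : Ω) • ((1 : Ω) ⊗ₜ[k] a) := by
        simp [TensorProduct.smul_tmul']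
      rw [h2, map_smul, h1, map_smul, hT]
      have h3 : ι (l • θ a) = (L.val l : Ω) • ι (θ a) := by
        ext i j
        rfl
      rw [h3, hθ]
      rfl
  have hinj : Function.Injective T := by
    have h1 : Function.Injective (LinearMap.rTensor A L.val.toLinearMap) :=
      Module.Flat.rTensor_preserves_injective_linearMap _ L.val.injective
    intro x y hxy
    refine h1 (E.injective ?_)
    rw [← hTι, ← hTι, hxy]
  have hbij : Function.Bijective T := by
    refine ⟨hinj, (LinearMap.injective_iff_surjective_of_finrank_eq_finrank ?_).1 hinj⟩
    rw [Module.finrank_baseChange, hrank, Module.finrank_matrix]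
    simp [sq]
  exact IsBaseChange.of_equiv (LinearEquiv.ofBijective T hbij) hT

/-- The extension to a `k`-algebra `R` of a splitting of `A` over `L`, with values in matrices over a
common extension of `R` and `L`. -/
def splitHom {L : Type u} [CommRing L] [Algebra k L] (θ : A →ₐ[k] Matrix (Fin n) (Fin n) L)
    (R R' : Type u) [CommRing R] [CommRing R'] [Algebra k R] [Algebra k R'] [Algebra R R']
    [IsScalarTower k R R'] [Algebra L R'] [IsScalarTower k L R'] :
    R ⊗[k] A →ₐ[R] Matrix (Fin n) (Fin n) R' :=
  Algebra.TensorProduct.lift (Algebra.ofId R _)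
    (((Algebra.ofId L R').mapMatrix.restrictScalars k).comp θ)
    fun r _ => Algebra.commutes r _

section SplitHom

variable {L : Type u} [CommRing L] [Algebra k L] (θ : A →ₐ[k] Matrix (Fin n) (Fin n) L)
    (R R' R'' : Type u) [CommRing R] [CommRing R'] [Algebra k R] [Algebra k R'] [Algebra R R']
    [IsScalarTower k R R'] [Algebra L R'] [IsScalarTower k L R']
    [CommRing R''] [Algebra k R''] [Algebra R R''] [IsScalarTower k R R''] [Algebra L R'']
    [IsScalarTower k L R''] [Algebra R' R''] [IsScalarTower R R' R''] [IsScalarTower L R' R'']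

theorem splitHom_tmul (r : R) (a : A) : splitHom θ R R' (r ⊗ₜ a) =
    r • (θ a).map (algebraMap L R') := by
  simp only [splitHom]
  rw [Algebra.smul_def]
  rfl

/-- Passing from `A` to matrices over `R'` through matrices over `L`, or through `R ⊗ A`, gives the
same map. The first route is a composite of base changes, and `A → R ⊗ A` is a base change, hence so
is the remaining map. -/
theorem isBaseChange_splitHom (hθ : IsBaseChange L θ.toLinearMap) :
    IsBaseChange R' (splitHom θ R R').toLinearMap := by
  have h₁ := hθ.comp (isBaseChange_mapMatrix (L := L) (R' := R') n)
  refine IsBaseChange.of_comp (TensorProduct.isBaseChange k A R) ?_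
  convert h₁ using 1
  ext a
  simp [splitHom_tmul]

theorem splitHom_map (x : R ⊗[k] A) :
    (splitHom θ R R' x).map (algebraMap R' R'') = splitHom θ R R'' x := by
  induction x using TensorProduct.induction_on with
  | zero => simp
  | add x y hx hy => rw [map_add, map_add, Matrix.map_add _ (map_add _), hx, hy]
  | tmul r a =>
    rw [splitHom_tmul, splitHom_tmul]
    ext i j
    rw [Matrix.map_apply, Matrix.smul_apply, Matrix.smul_apply, Matrix.map_apply, Matrix.map_apply,
      Algebra.smul_def, Algebra.smul_def, map_mul, ← IsScalarTower.algebraMap_apply,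
      ← IsScalarTower.algebraMap_apply]

end SplitHom

end Field

/-! ### Row spaces of idempotent matrices -/

section RowSpace

variable {R : Type u} [CommRing R] {n : ℕ} (e : Matrix (Fin n) (Fin n) R)

/-- The module generated by the rows of a matrix. -/
def rowSpace : Submodule R (Fin n → R) := LinearMap.range (Matrix.toLin' e.transpose)

/-- The map `x ↦ x e` onto the row space of `e`. -/
def rowProj : (Fin n → R) →ₗ[R] rowSpace e := (Matrix.toLin' e.transpose).rangeRestrict

theorem subtype_comp_rowProj :
    (rowSpace e).subtype ∘ₗ rowProj e = Matrix.toLin' e.transpose := rfl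

variable {e}

theorem rowProj_apply (he : IsIdempotentElem e) (x : rowSpace e) : rowProj e x.1 = x := by
  obtain ⟨_, y, rfl⟩ := x
  refine Subtype.ext ?_
  change Matrix.toLin' e.transpose (Matrix.toLin' e.transpose y) = Matrix.toLin' e.transpose y
  rw [← LinearMap.comp_apply, ← Matrix.toLin'_mul, ← Matrix.transpose_mul, he.eq]

theorem finite_rowSpace : Module.Finite R (rowSpace e) := by
  unfold rowSpace
  infer_instance

theorem projective_rowSpace (he : IsIdempotentElem e) : Module.Projective R (rowSpace e) :=
  Module.Projective.of_split (rowSpace e).subtype (rowProj e)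
    (LinearMap.ext (rowProj_apply he))

/-- The quotient of the algebra of matrices by the left ideal generated by `1 - e` is a power of
the row space of `e`. -/
def quotientEquivRowSpace (he : IsIdempotentElem e) :
    (Matrix (Fin n) (Fin n) R ⧸ Ideal.span {1 - e}) ≃ₗ[R] (Fin n → rowSpace e) := by
  let Φ : Matrix (Fin n) (Fin n) R →ₗ[R] (Fin n → rowSpace e) :=
    LinearMap.pi fun i => rowProj e ∘ₗ LinearMap.proj i
  have hΦ : Function.Surjective Φ := fun y => by
    refine ⟨fun i => (y i).1, funext fun i => ?_⟩
    exact rowProj_apply he (y i)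
  have hval : ∀ X i, (Φ X i).1 = (X * e) i := fun X i => by
    change Matrix.toLin' e.transpose (X i) = _
    ext j
    simp [Matrix.mulVec, Matrix.mul_apply, dotProduct, mul_comm]
  have hker : LinearMap.ker Φ = (Ideal.span {1 - e}).restrictScalars R := by
    ext X
    rw [LinearMap.mem_ker, Submodule.restrictScalars_mem, Ideal.mem_span_singleton']
    have h0 : Φ X = 0 ↔ X * e = 0 := by
      constructor
      · intro h
        ext i j
        rw [← hval, h]
        rfl
      · intro h
        refine funext fun i => Subtype.ext ?_
        rw [hval, h]
        rfl
    rw [h0]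
    constructor
    · intro h
      exact ⟨X, by rw [mul_sub, mul_one, h, sub_zero]⟩
    · rintro ⟨Y, rfl⟩
      rw [mul_assoc, sub_mul, one_mul, he.eq, sub_self, mul_zero]
  exact (Submodule.Quotient.restrictScalarsEquiv R (Ideal.span {1 - e})).symm ≪≫ₗ
    Submodule.quotEquivOfEq _ _ hker.symm ≪≫ₗ Φ.quotKerEquivOfSurjective hΦ

/-- The quotient is the `n`-th power of the row space, so `n` cancels from the ranks. -/
theorem rankAtStalk_rowSpace (he : IsIdempotentElem e) (hn : 1 ≤ n) {d : ℕ} 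
    (h : IsLocallyFreeOfRank R (Matrix (Fin n) (Fin n) R ⧸ Ideal.span {1 - e}) (n * d))
    (p : PrimeSpectrum R) : Module.rankAtStalk (rowSpace e) p = d := by
  have := finite_rowSpace (e := e)
  have := projective_rowSpace he
  have h₁ := h.2.2 p
  rw [Module.rankAtStalk_eq_of_equiv (quotientEquivRowSpace he), rankAtStalk_fin_fun] at h₁
  exact Nat.eq_of_mul_eq_mul_left hn h₁

/-- `P` is the transposed matrix of the inclusion of the row space and `Q` that of the projection.
The transposes appear because `e` acts on rows while linear maps are recorded on columns. -/
theorem exists_factorization_of_basis (he : IsIdempotentElem e) {S : Type u} [CommRing S]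
    [Algebra R S] {d : ℕ} (b : Module.Basis (Fin d) S (S ⊗[R] rowSpace e)) :
    ∃ (P : Matrix (Fin d) (Fin n) S) (Q : Matrix (Fin n) (Fin d) S),
      P * Q = 1 ∧ Q * P = e.map (algebraMap R S) := by
  let c := Algebra.TensorProduct.basis S (Pi.basisFun R (Fin n))
  let Q₀ := LinearMap.toMatrix b c ((rowSpace e).subtype.baseChange S)
  let P₀ := LinearMap.toMatrix c b ((rowProj e).baseChange S)
  have h₁ : P₀ * Q₀ = LinearMap.toMatrix b b
      ((rowProj e).baseChange S ∘ₗ (rowSpace e).subtype.baseChange S) :=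
    (LinearMap.toMatrix_comp b c b _ _).symm
  have h₂ : Q₀ * P₀ = LinearMap.toMatrix c c
      ((rowSpace e).subtype.baseChange S ∘ₗ (rowProj e).baseChange S) :=
    (LinearMap.toMatrix_comp c b c _ _).symm
  refine ⟨Q₀.transpose, P₀.transpose, ?_, ?_⟩
  · rw [← Matrix.transpose_mul, h₁, ← LinearMap.baseChange_comp,
      show rowProj e ∘ₗ (rowSpace e).subtype = LinearMap.id from
        LinearMap.ext (rowProj_apply he), LinearMap.baseChange_id, LinearMap.toMatrix_id,
      Matrix.transpose_one]
  · rw [← Matrix.transpose_mul, h₂, ← LinearMap.baseChange_comp,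
      subtype_comp_rowProj, LinearMap.toMatrix_baseChange]
    simp [LinearMap.toMatrix_eq_toMatrix', Matrix.transpose_map]

/-- The row space is finite projective of constant rank, hence free on a basic open neighbourhood of
`p`. -/
theorem exists_away_factorization (he : IsIdempotentElem e) {d : ℕ}
    (h : ∀ p : PrimeSpectrum R, Module.rankAtStalk (rowSpace e) p = d) (p : PrimeSpectrum R) :
    ∃ a ∉ p.asIdeal, ∃ (P : Matrix (Fin d) (Fin n) (Localization.Away a))
      (Q : Matrix (Fin n) (Fin d) (Localization.Away a)),
      P * Q = 1 ∧ Q * P = e.map (algebraMap R (Localization.Away a)) := by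
  have := finite_rowSpace (e := e)
  have := projective_rowSpace he
  obtain ⟨a, ha, hfree⟩ := Module.Free.away_of_finite_of_flat_of_rankAtStalk_constant
    (rowSpace e) p.asIdeal (fun m _ => (h _).trans (h _).symm)
  refine ⟨a, ha, ?_⟩
  let S := Localization.Away a
  -- Over the zero ring any matrices do; otherwise a prime of `S` is needed to read off the rank of
  -- the free module.
  rcases subsingleton_or_nontrivial S with hS | hS
  · exact ⟨0, 0, Subsingleton.elim _ _, Subsingleton.elim _ _⟩
  have : Module.Free S (S ⊗[R] rowSpace e) :=
    Module.Free.of_equiv (LocalizedModule.equivTensorProduct (Submonoid.powers a) (rowSpace e))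
  obtain ⟨q⟩ : Nonempty (PrimeSpectrum S) := inferInstance
  have hr : Module.finrank S (S ⊗[R] rowSpace e) = d := by
    have := Module.rankAtStalk_baseChange (R := R) (M := rowSpace e) q
    rw [Module.rankAtStalk_eq_finrank_of_free, h] at this
    exact this
  exact exists_factorization_of_basis he (Module.finBasisOfFinrankEq S _ hr)

/-- An idempotent matrix of constant rank `d` is, over a Zariski covering, of the form `Q P` with
`P Q = 1` of size `d`. -/
theorem exists_cover_factorization (he : IsIdempotentElem e) {d : ℕ}
    (h : ∀ p : PrimeSpectrum R, Module.rankAtStalk (rowSpace e) p = d) :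
    ∃ (S : Type u) (_ : CommRing S) (_ : Algebra R S), Algebra.Etale R S ∧
      Module.FaithfullyFlat R S ∧ ∃ (P : Matrix (Fin d) (Fin n) S) (Q : Matrix (Fin n) (Fin d) S),
      P * Q = 1 ∧ Q * P = e.map (algebraMap R S) := by
  choose a ha P Q hPQ hQP using exists_away_factorization he h
  have hspan : Ideal.span (Set.range a) = ⊤ := by
    by_contra hne
    obtain ⟨m, hm, hle⟩ := Ideal.exists_le_maximal _ hne
    exact ha ⟨m, hm.isPrime⟩ (hle (Ideal.subset_span ⟨_, rfl⟩))
  -- Quasi-compactness leaves finitely many basic opens. The product of their localizations is an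
  -- étale cover, and a matrix over the product is a family of matrices.
  obtain ⟨t, ht, htop⟩ := (Ideal.span_eq_top_iff_finite _).1 hspan
  choose q hq using fun x : t => ht x.2
  let S := ∀ x : t, Localization.Away (a (q x))
  let P' : Matrix (Fin d) (Fin n) S := Matrix.of fun i j x => P (q x) i j
  let Q' : Matrix (Fin n) (Fin d) S := Matrix.of fun i j x => Q (q x) i j
  let ev : ∀ x : t, S →+* Localization.Away (a (q x)) := fun x => Pi.evalRingHom _ x
  have hP' : ∀ x, P'.map (ev x) = P (q x) := fun x => rfl
  have hQ' : ∀ x, Q'.map (ev x) = Q (q x) := fun x => rfl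
  have hflat : Module.Flat R S := inferInstance
  have het : ∀ x : t, Algebra.Etale R (Localization.Away (a (q x))) := fun x =>
    Algebra.Etale.of_isLocalizationAway (a (q x))
  refine ⟨S, inferInstance, inferInstance, inferInstance, ?_, 
    P', Q', ?_, ?_⟩
  · refine Module.FaithfullyFlat.of_comap_surjective fun p => ?_
    obtain ⟨x, hx⟩ : ∃ x : t, x.1 ∉ p.asIdeal := by
      by_contra! hcon
      refine p.isPrime.ne_top (top_le_iff.1 (htop ▸ Ideal.span_le.2 fun y hy => hcon ⟨y, hy⟩))
    have hxp : p ∈ Set.range (PrimeSpectrum.comap (algebraMap R (Localization.Away (a (q x))))) := by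
      rw [PrimeSpectrum.localization_away_comap_range _ (a (q x)), hq x]
      exact hx
    obtain ⟨p', rfl⟩ := hxp
    exact ⟨p'.comap (Pi.evalRingHom _ x), rfl⟩
  · ext i j x
    have h₁ : (P' * Q').map (ev x) = (1 : Matrix (Fin d) (Fin d) S).map (ev x) := by
      rw [Matrix.map_mul, hP', hQ', hPQ, Matrix.map_one _ (map_zero _) (map_one _)]
    exact congrFun (congrFun h₁ i) j
  · ext i j x
    have h₁ : (Q' * P').map (ev x) = e.map (algebraMap R (Localization.Away (a (q x)))) := by
      rw [Matrix.map_mul, hP', hQ', hQP]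
    exact congrFun (congrFun h₁ i) j

end RowSpace

/-! ### Constant rank idempotents are split étale locally -/

section Main

variable {k : Type u} [Field k] {A : Type u} [Ring A] [Algebra k A] {n d : ℕ}

/-- An idempotent of the base change of a central simple algebra which has constant rank is split
by an étale covering. -/
theorem IsAzumayaOfDegree.isSplitIdempotent (hA : IsAzumayaOfDegree k A n) {R : Type u} [CommRing R]
    [Algebra k R] {e : R ⊗[k] A} (he : IsIdempotentElem e)
    (h : IsLocallyFreeOfRank R ((R ⊗[k] A) ⧸ Ideal.span {1 - e}) (n * d)) :
    IsSplitIdempotent R n d e := by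
  obtain ⟨hn, ⟨E⟩⟩ := hA
  obtain ⟨L, _, _, hL, θ, hθ⟩ := exists_finite_splitting E hn
  -- Over `R₁` the algebra is already a matrix algebra. A Zariski cover `S` of `R₁` then trivializes
  -- the row space of the idempotent, and `R → R₁ → S` is étale and faithfully flat.
  let R₁ := R ⊗[k] L
  let : Algebra L R₁ := Algebra.TensorProduct.rightAlgebra
  let ψ₁ := splitHom θ R R₁
  have hψ₁ : IsBaseChange R₁ ψ₁.toLinearMap := isBaseChange_splitHom θ R R₁ hθ
  have he₁ : IsIdempotentElem (ψ₁ e) := he.map ψ₁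
  have hloc : IsLocallyFreeOfRank R₁ (Matrix (Fin n) (Fin n) R₁ ⧸ Ideal.span {1 - ψ₁ e}) (n * d) := by
    have hb : IsAlgBaseChange (algebraMap R R₁) ψ₁.toRingHom :=
      isAlgBaseChange_algebraMap ψ₁ hψ₁
    have := hb.isLocallyFreeOfRank _ _ h
    rw [Ideal.map_span, Set.image_singleton] at this
    rwa [show ψ₁.toRingHom (1 - e) = 1 - ψ₁ e from (map_sub ψ₁ 1 e).trans (by rw [map_one])] at this
  obtain ⟨S, _, _, hS₁, hS₂, P, Q, hPQ, hQP⟩ := exists_cover_factorization he₁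
    (rankAtStalk_rowSpace he₁ hn hloc)
  let : Algebra R S := Algebra.compHom S (algebraMap R R₁)
  have : IsScalarTower R R₁ S := IsScalarTower.of_algebraMap_eq' rfl
  let : Algebra L S := Algebra.compHom S (algebraMap L R₁)
  have : IsScalarTower L R₁ S := IsScalarTower.of_algebraMap_eq' rfl
  let : Algebra k S := Algebra.compHom S (algebraMap k R₁)
  have : IsScalarTower k R₁ S := IsScalarTower.of_algebraMap_eq' rfl
  have : IsScalarTower k R S := IsScalarTower.of_algebraMap_eq fun x => by
    rw [IsScalarTower.algebraMap_apply R R₁ S, ← IsScalarTower.algebraMap_apply k R R₁,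
      ← IsScalarTower.algebraMap_apply k R₁ S]
  have : IsScalarTower k L S := IsScalarTower.of_algebraMap_eq fun x => by
    rw [IsScalarTower.algebraMap_apply L R₁ S, ← IsScalarTower.algebraMap_apply k L R₁,
      ← IsScalarTower.algebraMap_apply k R₁ S]
  refine ⟨S, inferInstance, inferInstance, Algebra.Etale.comp R R₁ S,
    Module.FaithfullyFlat.trans R R₁ S, splitHom θ R S, isBaseChange_splitHom θ R S hθ, P, Q, hPQ, ?_⟩
  rw [hQP, splitHom_map]

end Main

/-! ### Separability -/

section Separability

variable {k : Type u} [Field k] {A : Type u} [Ring A] [Algebra k A] {n : ℕ}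

/-- An algebra which is split by a field extension has a separability element. -/
theorem exists_separability_element {Ω : Type u} [Field Ω] [Algebra k Ω]
    (E : Ω ⊗[k] A ≃ₐ[Ω] Matrix (Fin n) (Fin n) Ω) (hn : 1 ≤ n) :
    ∃ τ : A ⊗[k] A, LinearMap.mul' k A τ = 1 ∧
      ∀ x : A, (LinearMap.mulLeft k x).rTensor A τ = (LinearMap.mulRight k x).lTensor A τ := by
  -- A `k`-linear retraction of `k → Ω` carries the standard separability element of the matrix
  -- algebra over `Ω` down to `A ⊗ A`.
  obtain ⟨l, hl⟩ := LinearMap.exists_leftInverse_of_injective (Algebra.linearMap k Ω)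
    (LinearMap.ker_eq_bot.2 (algebraMap k Ω).injective)
  have hl₁ : l 1 = 1 := by
    have := LinearMap.congr_fun hl 1
    simpa using this
  let Λ : (Ω ⊗[k] A) ⊗[k] (Ω ⊗[k] A) →ₗ[k] A ⊗[k] A :=
    (TensorProduct.lid k (A ⊗[k] A)).toLinearMap ∘ₗ
      LinearMap.rTensor (A ⊗[k] A) (l ∘ₗ LinearMap.mul' k Ω) ∘ₗ
        (TensorProduct.tensorTensorTensorComm k Ω A Ω A).toLinearMap
  let Λ₁ : Ω ⊗[k] A →ₗ[k] A := (TensorProduct.lid k A).toLinearMap ∘ₗ LinearMap.rTensor A l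
  have hΛ : ∀ c a c' a', Λ ((c ⊗ₜ a) ⊗ₜ (c' ⊗ₜ a')) = l (c * c') • (a ⊗ₜ[k] a') := by
    intros
    simp [Λ]
  -- `Λ` factors through the tensor product over `Ω`, so scalars of `Ω` can be moved across it.
  have hbal : ∀ (c : Ω) (x y : Ω ⊗[k] A), Λ ((c • x) ⊗ₜ y) = Λ (x ⊗ₜ (c • y)) := by
    intro c x y
    induction x using TensorProduct.induction_on with
    | zero => simp
    | add x₁ x₂ h₁ h₂ => simp only [smul_add, add_tmul, map_add, h₁, h₂]
    | tmul c₁ a =>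
      induction y using TensorProduct.induction_on with
      | zero => simp
      | add x₁ x₂ h₁ h₂ => simp only [smul_add, tmul_add, map_add, h₁, h₂]
      | tmul c₂ b =>
        rw [TensorProduct.smul_tmul', TensorProduct.smul_tmul', hΛ, hΛ, smul_eq_mul, smul_eq_mul]
        congr 2
        ring
  have hleft : ∀ (a : A) (x y : Ω ⊗[k] A),
      (LinearMap.mulLeft k a).rTensor A (Λ (x ⊗ₜ y)) = Λ (((1 ⊗ₜ a) * x) ⊗ₜ y) := by
    intro a x y
    induction x using TensorProduct.induction_on with
    | zero => simp
    | add x₁ x₂ h₁ h₂ => simp only [mul_add, add_tmul, map_add, h₁, h₂]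
    | tmul c₁ b =>
      induction y using TensorProduct.induction_on with
      | zero => simp
      | add x₁ x₂ h₁ h₂ => simp only [tmul_add, map_add, h₁, h₂]
      | tmul c₂ b' => simp [hΛ]
  have hright : ∀ (a : A) (x y : Ω ⊗[k] A),
      (LinearMap.mulRight k a).lTensor A (Λ (x ⊗ₜ y)) = Λ (x ⊗ₜ (y * (1 ⊗ₜ a))) := by
    intro a x y
    induction x using TensorProduct.induction_on with
    | zero => simp
    | add x₁ x₂ h₁ h₂ => simp only [add_tmul, map_add, h₁, h₂]
    | tmul c₁ b =>
      induction y using TensorProduct.induction_on with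
      | zero => simp
      | add x₁ x₂ h₁ h₂ => simp only [add_mul, tmul_add, map_add, h₁, h₂]
      | tmul c₂ b' => simp [hΛ]
  have hmul : ∀ x y : Ω ⊗[k] A, LinearMap.mul' k A (Λ (x ⊗ₜ y)) = Λ₁ (x * y) := by
    intro x y
    induction x using TensorProduct.induction_on with
    | zero => simp
    | add x₁ x₂ h₁ h₂ => simp only [add_mul, add_tmul, map_add, h₁, h₂]
    | tmul c₁ b =>
      induction y using TensorProduct.induction_on with
      | zero => simp
      | add x₁ x₂ h₁ h₂ => simp only [mul_add, tmul_add, map_add, h₁, h₂]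
      | tmul c₂ b' => simp [hΛ, Λ₁]
  let o : Fin n := ⟨0, hn⟩
  -- The separability element over `Ω` is the sum of `E_{i o} ⊗ E_{o i}`, for a column `o` that
  -- exists since `n ≥ 1`.
  let u : Fin n → Ω ⊗[k] A := fun i => E.symm (Matrix.single i o 1)
  let v : Fin n → Ω ⊗[k] A := fun i => E.symm (Matrix.single o i 1)
  have huv : ∑ i, u i * v i = 1 := by
    simp only [u, v, ← map_mul, Matrix.single_mul_single_same, mul_one]
    rw [← map_sum, Matrix.sum_single_one, map_one]
  have hyu : ∀ (y : Ω ⊗[k] A) i, y * u i = ∑ p, E y p i • u p := by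
    intro y i
    apply E.injective
    simp only [map_mul, map_sum, map_smul, u, AlgEquiv.apply_symm_apply]
    ext a b
    simp [Matrix.mul_apply, Matrix.sum_apply, Matrix.single_apply]
    by_cases hb : o = b <;> simp [hb]
  have hvy : ∀ (y : Ω ⊗[k] A) p, v p * y = ∑ i, E y p i • v i := by
    intro y p
    apply E.injective
    simp only [map_mul, map_sum, map_smul, v, AlgEquiv.apply_symm_apply]
    ext a b
    simp [Matrix.mul_apply, Matrix.sum_apply, Matrix.single_apply]
    by_cases hb : o = a <;> simp [hb]
  refine ⟨∑ i, Λ (u i ⊗ₜ v i), ?_, fun x => ?_⟩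
  · simp only [map_sum, hmul]
    rw [← map_sum, huv]
    simp [Λ₁, Algebra.TensorProduct.one_def, hl₁]
  · simp only [map_sum, hleft, hright, hyu, hvy, sum_tmul, tmul_sum, hbal]
    rw [Finset.sum_comm]

/-- A left ideal of the base change of a central simple algebra, with projective quotient, is
generated by an idempotent. -/
theorem IsAzumayaOfDegree.exists_idempotent (hA : IsAzumayaOfDegree k A n) {R : Type u} [CommRing R]
    [Algebra k R] (I : Ideal (R ⊗[k] A)) (hI : Module.Projective R ((R ⊗[k] A) ⧸ I)) :
    ∃ e, IsIdempotentElem e ∧ I = Ideal.span {e} := by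
  obtain ⟨hn, ⟨E⟩⟩ := hA
  obtain ⟨τ, hτ₁, hτ⟩ := exists_separability_element E hn
  let π : R ⊗[k] A →ₗ[R] (R ⊗[k] A) ⧸ I := I.mkQ.restrictScalars R
  obtain ⟨σ, hσ⟩ := Module.projective_lifting_property π LinearMap.id I.mkQ_surjective
  have hσ' : ∀ m, π (σ m) = m := fun m => LinearMap.congr_fun hσ m
  -- Averaging of the section `σ`: for `τ = ∑ a ⊗ b`, `Γ x τ = ∑ a σ(b x̄)`. The identity `x τ = τ
  -- x` makes it left linear over `R ⊗ A` in `x`, and `∑ a b = 1` makes it a section of `π`.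
  let Γ : R ⊗[k] A → A ⊗[k] A →ₗ[k] R ⊗[k] A := fun x =>
    TensorProduct.lift (LinearMap.mk₂ k (fun a b => (1 ⊗ₜ a) * σ (π ((1 ⊗ₜ b) * x)))
      (fun a a' b => by rw [tmul_add, add_mul])
      (fun c a b => by rw [tmul_smul, smul_mul_assoc])
      (fun a b b' => by rw [tmul_add, add_mul, map_add, map_add, mul_add])
      (fun c a b => by
        rw [tmul_smul, smul_mul_assoc, ← algebraMap_smul R c, map_smul, map_smul, mul_smul_comm,
          algebraMap_smul]))
  have hΓ : ∀ x a b, Γ x (a ⊗ₜ b) = (1 ⊗ₜ a) * σ (π ((1 ⊗ₜ b) * x)) := fun x a b => rfl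
  have hΓadd : ∀ x y t, Γ (x + y) t = Γ x t + Γ y t := by
    intro x y t
    induction t using TensorProduct.induction_on with
    | zero => simp
    | add t₁ t₂ h₁ h₂ => rw [map_add, h₁, h₂, map_add, map_add]; abel
    | tmul a b => rw [hΓ, hΓ, hΓ, mul_add, map_add, map_add, mul_add]
  have hΓsmul : ∀ (r : R) x t, Γ (r • x) t = r • Γ x t := by
    intro r x t
    induction t using TensorProduct.induction_on with
    | zero => simp
    | add t₁ t₂ h₁ h₂ => rw [map_add, h₁, h₂, map_add, smul_add]
    | tmul a b => rw [hΓ, hΓ, mul_smul_comm, map_smul, map_smul, mul_smul_comm]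
  have hΓzero : ∀ x ∈ I, ∀ t, Γ x t = 0 := by
    intro x hx t
    induction t using TensorProduct.induction_on with
    | zero => simp
    | add t₁ t₂ h₁ h₂ => rw [map_add, h₁, h₂, add_zero]
    | tmul a b =>
      have : π ((1 ⊗ₜ b) * x) = 0 := (Submodule.Quotient.mk_eq_zero I).2 (I.mul_mem_left _ hx)
      rw [hΓ, this, map_zero, mul_zero]
  have hΓleft : ∀ a x t, (1 ⊗ₜ a) * Γ x t = Γ x ((LinearMap.mulLeft k a).rTensor A t) := by
    intro a x t
    induction t using TensorProduct.induction_on with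
    | zero => simp
    | add t₁ t₂ h₁ h₂ => rw [map_add, mul_add, h₁, h₂, map_add, map_add]
    | tmul b b' =>
      rw [LinearMap.rTensor_tmul, hΓ, hΓ, ← mul_assoc, Algebra.TensorProduct.tmul_mul_tmul, mul_one]
      rfl
  have hΓright : ∀ a x t, Γ ((1 ⊗ₜ a) * x) t = Γ x ((LinearMap.mulRight k a).lTensor A t) := by
    intro a x t
    induction t using TensorProduct.induction_on with
    | zero => simp
    | add t₁ t₂ h₁ h₂ => rw [map_add, h₁, h₂, map_add, map_add]
    | tmul b b' =>
      rw [LinearMap.lTensor_tmul, hΓ, hΓ, ← mul_assoc, Algebra.TensorProduct.tmul_mul_tmul, mul_one]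
      rfl
  have hΓπ : ∀ t, π (Γ 1 t) = π (1 ⊗ₜ LinearMap.mul' k A t) := by
    intro t
    induction t using TensorProduct.induction_on with
    | zero => simp
    | add t₁ t₂ h₁ h₂ => rw [map_add, map_add, h₁, h₂, map_add, tmul_add, map_add]
    | tmul a b =>
      have h₁ : ∀ y, π ((1 ⊗ₜ a) * y) = ((1 : R) ⊗ₜ[k] a) • π y := fun y => rfl
      rw [hΓ, mul_one, h₁, hσ', ← h₁, Algebra.TensorProduct.tmul_mul_tmul, mul_one]
      rfl
  have hlin : ∀ x, x * Γ 1 τ = Γ x τ := by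
    intro x
    induction x using TensorProduct.induction_on with
    | zero => rw [zero_mul, hΓzero 0 I.zero_mem]
    | add x y hx hy => rw [add_mul, hx, hy, hΓadd]
    | tmul r a =>
      have h₁ : r ⊗ₜ[k] a = r • ((1 : R) ⊗ₜ[k] a) := by rw [smul_tmul', smul_eq_mul, mul_one]
      have h₂ := hΓright a 1 τ
      rw [mul_one] at h₂
      rw [h₁, smul_mul_assoc, hΓleft, hτ, hΓsmul, h₂]
  have hmem : 1 - Γ 1 τ ∈ I := by
    refine (Submodule.Quotient.mk_eq_zero I).1 ?_
    change π (1 - Γ 1 τ) = 0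
    rw [map_sub, hΓπ, hτ₁, ← Algebra.TensorProduct.one_def, sub_self]
  -- By linearity, right multiplication by `Γ 1 τ` is `x ↦ Γ x τ`, which kills `I`. Right
  -- multiplication by `1 - Γ 1 τ` is thus a projection onto `I`.
  have hmul : ∀ x ∈ I, x * (1 - Γ 1 τ) = x := fun x hx => by
    rw [mul_sub, mul_one, hlin, hΓzero x hx, sub_zero]
  refine ⟨1 - Γ 1 τ, hmul _ hmem, le_antisymm (fun x hx => ?_) ?_⟩
  · exact Ideal.mem_span_singleton'.2 ⟨x, hmul x hx⟩
  · rwa [Ideal.span_singleton_le_iff_mem]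

end Separability

/-! ### Left ideals of an algebra and of its corners -/

section LocallyFree

variable {R : Type u} [CommRing R] {M N : Type u} [AddCommGroup M] [AddCommGroup N] [Module R M]
  [Module R N]

theorem IsLocallyFreeOfRank.of_equiv {d : ℕ} (h : IsLocallyFreeOfRank R M d) (E : M ≃ₗ[R] N) :
    IsLocallyFreeOfRank R N d := by
  obtain ⟨_, _, h₃⟩ := h
  refine ⟨Module.Finite.equiv E, Module.Projective.of_equiv E, fun p => ?_⟩
  rw [← h₃ p, Module.rankAtStalk_eq_of_equiv E]

theorem IsLocallyFreeOfRank.prod_iff {d d' : ℕ} (hN : IsLocallyFreeOfRank R N d') :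
    IsLocallyFreeOfRank R (M × N) (d + d') ↔ IsLocallyFreeOfRank R M d := by
  obtain ⟨_, _, hN₃⟩ := hN
  constructor
  · rintro ⟨_, _, h₃⟩
    have : Module.Finite R M := Module.Finite.of_surjective (LinearMap.fst R M N) Prod.fst_surjective
    have : Module.Projective R M :=
      Module.Projective.of_split (LinearMap.inl R M N) (LinearMap.fst R M N) rfl
    refine ⟨inferInstance, inferInstance, fun p => ?_⟩
    have := h₃ p
    rw [Module.rankAtStalk_prod, Pi.add_apply, hN₃] at this
    omega
  · rintro ⟨_, _, h₃⟩
    refine ⟨inferInstance, inferInstance, fun p => ?_⟩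
    rw [Module.rankAtStalk_prod, Pi.add_apply, hN₃, h₃]

theorem projective_pi_fin [Module.Projective R M] (m : ℕ) : Module.Projective R (Fin m → M) :=
  Module.Projective.of_equiv (DirectSum.linearEquivFunOnFintype R (Fin m) fun _ => M)

end LocallyFree

/-! ### Morita correspondence for left ideals of a corner -/

section CornerIdeal

variable {R : Type u} [CommRing R] {B : Type u} [Ring B] [Algebra R B] {e : B}
  (he : IsIdempotentElem e)

/-- The intersection of a left ideal with a corner. -/
def cornerComap (K : Ideal B) : Ideal he.Corner where
  carrier := {x | x.1 ∈ K}
  add_mem' hx hy := K.add_mem hx hy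
  zero_mem' := K.zero_mem
  smul_mem' c _ hx := K.mul_mem_left c.1 hx

/-- The left ideal generated by a left ideal of a corner. -/
def cornerSpan (J : Ideal he.Corner) : Ideal B := 
  Ideal.span ((fun x : he.Corner => x.1) '' (J : Set he.Corner))

variable {he}

theorem mem_cornerComap {K : Ideal B} {x : he.Corner} : x ∈ cornerComap he K ↔ x.1 ∈ K := Iff.rfl

theorem cornerComap_mono {K K' : Ideal B} (h : K ≤ K') : cornerComap he K ≤ cornerComap he K' :=
  fun _ hx => h hx

theorem cornerSpan_mono {J J' : Ideal he.Corner} (h : J ≤ J') : cornerSpan he J ≤ cornerSpan he J' :=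
  Ideal.span_mono (Set.image_mono h)

theorem val_mem_cornerSpan {J : Ideal he.Corner} {x : he.Corner} (hx : x ∈ J) :
    x.1 ∈ cornerSpan he J :=
  Ideal.subset_span ⟨x, hx, rfl⟩

theorem cornerSpan_le_iff {J : Ideal he.Corner} {K : Ideal B} :
    cornerSpan he J ≤ K ↔ J ≤ cornerComap he K := by
  rw [cornerSpan, Ideal.span_le, Set.image_subset_iff]
  rfl

theorem cornerSpan_le (J : Ideal he.Corner) : cornerSpan he J ≤ Ideal.span {e} :=
  cornerSpan_le_iff.2 fun x _ => Ideal.mem_span_singleton'.2 ⟨x.1, corner_right he x⟩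

theorem mul_idempotent_of_mem {x : B} (he : IsIdempotentElem e) (hx : x ∈ Ideal.span {e}) :
    x * e = x := by
  obtain ⟨y, rfl⟩ := Ideal.mem_span_singleton'.1 hx
  rw [mul_assoc, he.eq]

theorem mul_idempotent_of_mem_one_sub {x : B} (he : IsIdempotentElem e)
    (hx : x ∈ Ideal.span {1 - e}) : x * e = 0 := by
  obtain ⟨y, rfl⟩ := Ideal.mem_span_singleton'.1 hx
  rw [mul_assoc, sub_mul, one_mul, he.eq, sub_self, mul_zero]

theorem cornerMk_mem (J : Ideal he.Corner) {y : B}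
    (hy : y ∈ Ideal.span {1 - e} ⊔ cornerSpan he J) : cornerMk he y ∈ J := by
  obtain ⟨a, ha, b, hb, rfl⟩ := Submodule.mem_sup.1 hy
  have h₁ : cornerMk he (a + b) = cornerMk he b := Subtype.ext (by
    rw [cornerMk_val, cornerMk_val, mul_add, add_mul, mul_assoc e a,
      mul_idempotent_of_mem_one_sub he ha, mul_zero, zero_add])
  rw [h₁]
  -- A free left factor `c` lets the span induction pass through multiplication by ring elements; on
  -- generators `e c x e = (e c e) x`.
  suffices h : ∀ c, cornerMk he (c * b) ∈ J by simpa using h 1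
  refine Submodule.span_induction (p := fun b _ => ∀ c, cornerMk he (c * b) ∈ J) ?_ ?_ ?_ ?_ hb
  · rintro _ ⟨x, hx, rfl⟩ c
    have : cornerMk he (c * x.1) = cornerMk he c * x := Subtype.ext (by
      rw [cornerMk_val, corner_mul_val, cornerMk_val, mul_assoc, mul_assoc c, corner_right,
        mul_assoc (e * c), corner_left, mul_assoc])
    rw [this]
    exact J.mul_mem_left _ hx
  · intro c
    have : cornerMk he (c * 0) = 0 := Subtype.ext (by simp)
    rw [this]
    exact J.zero_mem
  · intro x y _ _ hx hy c
    have : cornerMk he (c * (x + y)) = cornerMk he (c * x) + cornerMk he (c * y) :=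
      Subtype.ext (by simp [mul_add, add_mul])
    rw [this]
    exact J.add_mem (hx c) (hy c)
  · intro c x _ hx c'
    rw [smul_eq_mul, ← mul_assoc]
    exact hx _

theorem cornerComap_sup_cornerSpan (J : Ideal he.Corner) :
    cornerComap he (Ideal.span {1 - e} ⊔ cornerSpan he J) = J := by
  refine le_antisymm (fun x hx => ?_) (cornerSpan_le_iff.1 le_sup_right)
  rw [← cornerMk_val_self he x]
  exact cornerMk_mem J hx

theorem cornerComap_cornerSpan (J : Ideal he.Corner) : cornerComap he (cornerSpan he J) = J :=
  le_antisymm ((cornerComap_mono le_sup_right).trans (cornerComap_sup_cornerSpan J).le)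
    (cornerSpan_le_iff.1 le_rfl)

variable (e) in
/-- The idempotent `e` is full: it generates the unit two-sided ideal. -/
def IsFull : Prop := ∃ (m : ℕ) (x y : Fin m → B), ∑ t, x t * e * y t = 1

/-- If `1 = ∑ x_t e y_t` and `z = z e`, then `z = ∑ x_t (e y_t z e)` with every `e y_t z e` in `K`
and in the corner. -/
theorem cornerSpan_cornerComap (hf : IsFull e) {K : Ideal B} (hK : K ≤ Ideal.span {e}) :
    cornerSpan he (cornerComap he K) = K := by
  refine le_antisymm (cornerSpan_le_iff.2 le_rfl) fun z hz => ?_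
  obtain ⟨m, x, y, hxy⟩ := hf
  have hze := mul_idempotent_of_mem he (hK hz)
  have : z = ∑ t, x t * (cornerMk he (y t * z)).1 := by
    simp only [cornerMk_val, mul_assoc, hze]
    simp only [← mul_assoc]
    rw [← Finset.sum_mul, hxy, one_mul]
  rw [this]
  refine Submodule.sum_mem _ fun t _ => Ideal.mul_mem_left _ _ (val_mem_cornerSpan ?_)
  rw [mem_cornerComap, cornerMk_val, mul_assoc, mul_assoc, hze]
  exact K.mul_mem_left _ (K.mul_mem_left _ hz)

theorem mul_idempotent_mem {K : Ideal B} (hK : 1 - e ∈ K) {z : B} (hz : z ∈ K) : z * e ∈ K := by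
  have : z * e = z - z * (1 - e) := by rw [mul_sub, mul_one, sub_sub_cancel]
  rw [this]
  exact K.sub_mem hz (K.mul_mem_left _ hK)

/-- Here `z = z (1 - e) + z e`, and `z e` lies in `K` because `1 - e` does; fullness then expands `z
e` in elements of the corner. -/
theorem sup_cornerSpan_cornerComap (hf : IsFull e) {K : Ideal B} (hK : 1 - e ∈ K) :
    Ideal.span {1 - e} ⊔ cornerSpan he (cornerComap he K) = K := by
  refine le_antisymm (sup_le ((Ideal.span_singleton_le_iff_mem K).2 hK)
    (cornerSpan_le_iff.2 le_rfl)) fun z hz => ?_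
  obtain ⟨m, x, y, hxy⟩ := hf
  have hz' : z = z * (1 - e) + ∑ t, x t * (cornerMk he (y t * z)).1 := by
    have : ∑ t, x t * (cornerMk he (y t * z)).1 = z * e := by
      simp only [cornerMk_val, ← mul_assoc]
      rw [← Finset.sum_mul, ← Finset.sum_mul, hxy, one_mul]
    rw [this, mul_sub, mul_one, sub_add_cancel]
  rw [hz']
  refine Submodule.add_mem_sup (Ideal.mul_mem_left _ _ (Ideal.mem_span_singleton_self _))
    (Submodule.sum_mem _ fun t _ => Ideal.mul_mem_left _ _ (val_mem_cornerSpan ?_))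
  rw [mem_cornerComap, cornerMk_val]
  exact mul_idempotent_mem hK (K.mul_mem_left _ (K.mul_mem_left _ hz))

variable (R he) in
/-- The inclusion of the quotient of a corner in the quotient of the algebra. -/
def cornerQuotientVal (K : Ideal B) : (he.Corner ⧸ cornerComap he K) →ₗ[R] (B ⧸ K) :=
  (Submodule.liftQ ((cornerComap he K).restrictScalars R)
    (K.mkQ.restrictScalars R ∘ₗ cornerVal R he)
    fun _ hx => (Submodule.Quotient.mk_eq_zero K).2 hx) ∘ₗ
    (Submodule.Quotient.restrictScalarsEquiv R (cornerComap he K)).symm.toLinearMap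

variable (R he) in
/-- The projection of the quotient of the algebra on the quotient of a corner. -/
def cornerQuotientProj {K : Ideal B} (hK : 1 - e ∈ K) :
    (B ⧸ K) →ₗ[R] (he.Corner ⧸ cornerComap he K) :=
  (Submodule.liftQ (K.restrictScalars R)
    ((cornerComap he K).mkQ.restrictScalars R ∘ₗ cornerProj R he)
    fun _ hx => (Submodule.Quotient.mk_eq_zero (cornerComap he K)).2
      (mul_idempotent_mem hK (K.mul_mem_left e hx))) ∘ₗ
    (Submodule.Quotient.restrictScalarsEquiv R K).symm.toLinearMap

theorem cornerQuotientProj_val {K : Ideal B} (hK : 1 - e ∈ K) (z : he.Corner ⧸ cornerComap he K) :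
    cornerQuotientProj R he hK (cornerQuotientVal R he K z) = z := by
  obtain ⟨x, rfl⟩ := Submodule.Quotient.mk_surjective _ z
  exact congrArg (Submodule.Quotient.mk (p := cornerComap he K)) (cornerMk_val_self he x)

theorem cornerQuotientVal_proj {K : Ideal B} (hK : 1 - e ∈ K) (z : B ⧸ K) :
    cornerQuotientVal R he K (cornerQuotientProj R he hK z) = e • z := by
  obtain ⟨x, rfl⟩ := Submodule.Quotient.mk_surjective _ z
  change Submodule.Quotient.mk (p := K) (e * x * e) = Submodule.Quotient.mk (p := K) (e * x)
  rw [Submodule.Quotient.eq]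
  have : e * x * e - e * x = -(e * x * (1 - e)) := by rw [mul_sub, mul_one, neg_sub]
  rw [this]
  exact K.neg_mem (K.mul_mem_left _ hK)

/-- Comparison of ranks for left ideals containing `1 - e` and left ideals of the corner. -/
theorem IsSplitIdempotent.isLocallyFreeOfRank_iff {n d : ℕ} (hs : IsSplitIdempotent R n d e)
    (hn : 1 ≤ n) (hd : 1 ≤ d) {K : Ideal B} (hK : 1 - e ∈ K) (c : ℕ) :
    IsLocallyFreeOfRank R (he.Corner ⧸ cornerComap he K) (d * c) ↔
      IsLocallyFreeOfRank R (B ⧸ K) (n * c) := by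
  have h₁ := cornerQuotientProj_val (R := R) (he := he) hK
  have h₂ := cornerQuotientVal_proj (R := R) (he := he) hK
  constructor
  · rintro ⟨hfin, hproj, hrk⟩
    obtain ⟨m, x, y, hxy⟩ := hs.exists_sum_eq_one hd
    -- Fullness makes `B / K` a direct summand of a power of the quotient of the corner, so
    -- finiteness and projectivity pass to it.
    let F : (B ⧸ K) →ₗ[R] (Fin m → he.Corner ⧸ cornerComap he K) :=
      LinearMap.pi fun t => cornerQuotientProj R he hK ∘ₗ Algebra.lsmul R R (B ⧸ K) (y t)
    let G : (Fin m → he.Corner ⧸ cornerComap he K) →ₗ[R] (B ⧸ K) :=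
      ∑ t, Algebra.lsmul R R (B ⧸ K) (x t) ∘ₗ cornerQuotientVal R he K ∘ₗ LinearMap.proj t
    have hGF : G ∘ₗ F = LinearMap.id := by
      ext z
      simp only [G, F, LinearMap.comp_apply, LinearMap.sum_apply, LinearMap.pi_apply,
        LinearMap.proj_apply, Algebra.lsmul_coe, h₂, LinearMap.id_apply]
      simp only [← mul_smul]
      rw [← Finset.sum_smul]
      simp only [← mul_assoc]
      rw [hxy, one_smul]
    have : Module.Finite R (B ⧸ K) :=
      Module.Finite.of_surjective G fun z => ⟨F z, LinearMap.congr_fun hGF z⟩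
    have : Module.Projective R (Fin m → he.Corner ⧸ cornerComap he K) :=
      projective_pi_fin m
    have : Module.Projective R (B ⧸ K) := Module.Projective.of_split F G hGF
    refine ⟨inferInstance, inferInstance, fun p => ?_⟩
    have := hs.mul_rankAtStalk _ _ h₁ h₂ p
    rw [hrk] at this
    refine Nat.eq_of_mul_eq_mul_left hd ?_
    rw [← this]
    ring
  · rintro ⟨hfin, hproj, hrk⟩
    have : Module.Finite R (he.Corner ⧸ cornerComap he K) :=
      Module.Finite.of_surjective (cornerQuotientProj R he hK) fun z => ⟨_, h₁ z⟩
    have : Module.Projective R (he.Corner ⧸ cornerComap he K) :=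
      Module.Projective.of_split (cornerQuotientVal R he K) (cornerQuotientProj R he hK)
        (LinearMap.ext h₁)
    refine ⟨inferInstance, inferInstance, fun p => ?_⟩
    have := hs.mul_rankAtStalk _ _ h₁ h₂ p
    rw [hrk] at this
    refine Nat.eq_of_mul_eq_mul_left hn ?_
    rw [this]
    ring

variable (R) in
/-- The decomposition of the quotient by a left ideal contained in `B e`. -/
def quotientEquivProd (he : IsIdempotentElem e) {I : Ideal B} (hI : I ≤ Ideal.span {e}) :
    (B ⧸ I) ≃ₗ[R] (B ⧸ (Ideal.span {1 - e} ⊔ I)) × (B ⧸ Ideal.span {e}) := by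
  let Φ : B →ₗ[R] (B ⧸ (Ideal.span {1 - e} ⊔ I)) × (B ⧸ Ideal.span {e}) :=
    (((Ideal.span {1 - e} ⊔ I).mkQ).restrictScalars R).prod
      ((Ideal.span {e}).mkQ.restrictScalars R)
  have hΦ : Function.Surjective Φ := by
    rintro ⟨a, b⟩
    obtain ⟨a, rfl⟩ := Submodule.Quotient.mk_surjective _ a
    obtain ⟨b, rfl⟩ := Submodule.Quotient.mk_surjective _ b
    -- This element differs from `a` by `(b - a) (1 - e)` and from `b` by `(a - b) e`.
    refine ⟨a * e + b * (1 - e), Prod.ext ?_ ?_⟩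
    · refine (Submodule.Quotient.eq _).2 (Submodule.mem_sup_left (Ideal.mem_span_singleton'.2
        ⟨b - a, ?_⟩))
      simp only [mul_sub, sub_mul, mul_one]
      abel
    · refine (Submodule.Quotient.eq _).2 (Ideal.mem_span_singleton'.2 ⟨a - b, ?_⟩)
      simp only [mul_sub, sub_mul, mul_one]
      abel
  have hker : LinearMap.ker Φ = I.restrictScalars R := by
    ext z
    have h0 : z ∈ LinearMap.ker Φ ↔ z ∈ Ideal.span {1 - e} ⊔ I ∧ z ∈ Ideal.span {e} := by
      rw [LinearMap.mem_ker, Prod.ext_iff]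
      exact and_congr (Submodule.Quotient.mk_eq_zero _) (Submodule.Quotient.mk_eq_zero _)
    rw [h0, Submodule.restrictScalars_mem]
    constructor
    · rintro ⟨h₁, h₂⟩
      obtain ⟨a, ha, b, hb, rfl⟩ := Submodule.mem_sup.1 h₁
      rw [← mul_idempotent_of_mem he h₂, add_mul, mul_idempotent_of_mem_one_sub he ha, zero_add,
        mul_idempotent_of_mem he (hI hb)]
      exact hb
    · exact fun h => ⟨Submodule.mem_sup_right h, hI h⟩
  exact (Submodule.Quotient.restrictScalarsEquiv R I).symm ≪≫ₗ
    Submodule.quotEquivOfEq _ _ hker.symm ≪≫ₗ Φ.quotKerEquivOfSurjective hΦ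

theorem cornerComap_sup {I : Ideal B} (hI : I ≤ Ideal.span {e}) :
    cornerComap he (Ideal.span {1 - e} ⊔ I) = cornerComap he I := by
  refine le_antisymm (fun x hx => ?_) (cornerComap_mono le_sup_right)
  obtain ⟨a, ha, b, hb, hab⟩ := Submodule.mem_sup.1 (mem_cornerComap.1 hx)
  rw [mem_cornerComap, ← corner_right he x, ← hab, add_mul, mul_idempotent_of_mem_one_sub he ha,
    zero_add, mul_idempotent_of_mem he (hI hb)]
  exact hb

/-- Comparison of ranks for left ideals contained in `B e` and left ideals of the corner. -/
theorem IsSplitIdempotent.isLocallyFreeOfRank_iff_of_le {n d : ℕ} (hs : IsSplitIdempotent R n d e)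
    (hn : 1 ≤ n) (hd : 1 ≤ d) {f : ℕ} (hf : IsLocallyFreeOfRank R (B ⧸ Ideal.span {e}) f)
    {I : Ideal B} (hI : I ≤ Ideal.span {e}) (c : ℕ) :
    IsLocallyFreeOfRank R (he.Corner ⧸ cornerComap he I) (d * c) ↔
      IsLocallyFreeOfRank R (B ⧸ I) (n * c + f) := by
  rw [← cornerComap_sup hI, hs.isLocallyFreeOfRank_iff hn hd
    (Submodule.mem_sup_left (Ideal.mem_span_singleton_self _)), ← hf.prod_iff]
  exact ⟨fun h => h.of_equiv (quotientEquivProd R he hI).symm,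
    fun h => h.of_equiv (quotientEquivProd R he hI)⟩

end CornerIdeal

/-! ### Compatibility with base change -/

section Associated

variable {B : Type u} [Ring B] {a b c : B}

/-- The idempotents `a` and `b` generate the same left ideal. -/
structure LeftAssociated (a b : B) : Prop where
  left : a * b = a
  right : b * a = b

/-- The idempotents `a` and `b` generate the same right ideal. -/
structure RightAssociated (a b : B) : Prop where
  left : a * b = b
  right : b * a = a

theorem leftAssociated_of_span_eq (ha : IsIdempotentElem a) (hb : IsIdempotentElem b)
    (h : Ideal.span {a} = Ideal.span {b}) : LeftAssociated a b :=
  ⟨mul_idempotent_of_mem hb (h ▸ Ideal.mem_span_singleton_self a),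
    mul_idempotent_of_mem ha (h ▸ Ideal.mem_span_singleton_self b)⟩

/-- Equal left ideals have equal right annihilators, and for an idempotent `a` the annihilator of `B
a` is `(1 - a) B`. -/
theorem LeftAssociated.one_sub (h : LeftAssociated a b) : RightAssociated (1 - a) (1 - b) := by
  constructor
  · rw [sub_mul, one_mul, mul_sub a, mul_one, h.left, sub_self, sub_zero]
  · rw [sub_mul, one_mul, mul_sub b, mul_one, h.right, sub_self, sub_zero]

theorem LeftAssociated.cornerCompatible (h : LeftAssociated a b) (ha : IsIdempotentElem a)
    (hb : IsIdempotentElem b) : CornerCompatible a b :=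
  ⟨by rw [h.left, ha.eq], by rw [h.right, hb.eq]⟩

theorem RightAssociated.cornerCompatible (h : RightAssociated a b) (ha : IsIdempotentElem a)
    (hb : IsIdempotentElem b) : CornerCompatible a b :=
  ⟨by rw [mul_assoc, h.right, ha.eq], by rw [mul_assoc, h.left, hb.eq]⟩

end Associated

/-! ### Base change of the Morita correspondence -/

section CornerIdealMap

variable {B B' : Type u} [Ring B] [Ring B'] {e : B} {he : IsIdempotentElem e} {e' : B'}
  {he' : IsIdempotentElem e'} {φ : B →+* B'}

/-- For `x` in the corner the transition map is `x ↦ e' φ(x)`, and `φ(x) = φ(e) e' φ(x)`, so both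
elements generate the same left ideal. -/
theorem map_cornerSpan (h : LeftAssociated (φ e) e') (hc : CornerCompatible (φ e) e')
    (J : Ideal he.Corner) :
    (cornerSpan he J).map φ = cornerSpan he' (J.map (cornerMap he he' φ hc)) := by
  have hval : ∀ x : he.Corner, (cornerMap he he' φ hc x).1 = e' * φ x.1 := fun x => by
    rw [cornerMap_val, ← corner_right he x, map_mul, mul_assoc, mul_assoc (φ x.1), h.left]
  refine le_antisymm ?_ ?_
  · rw [Ideal.map_le_iff_le_comap, cornerSpan_le_iff]
    intro x hx
    have h₁ : φ x.1 = φ e * (cornerMap he he' φ hc x).1 := by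
      rw [hval, ← mul_assoc, h.left, ← map_mul, corner_left]
    rw [mem_cornerComap, Ideal.mem_comap, h₁]
    exact Ideal.mul_mem_left _ _ (val_mem_cornerSpan (Ideal.mem_map_of_mem _ hx))
  · rw [cornerSpan_le_iff, Ideal.map_le_iff_le_comap]
    intro x hx
    rw [Ideal.mem_comap, mem_cornerComap, hval]
    exact Ideal.mul_mem_left _ _ (Ideal.mem_map_of_mem φ (val_mem_cornerSpan hx))

/-- The transition map is now `x ↦ φ(x) e'`, which agrees with `φ(x)` modulo the left ideal of `1 -
e'`; that ideal is also generated by `φ (1 - e)`. -/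
theorem map_sup_cornerSpan (h : RightAssociated (φ e) e') (hc : CornerCompatible (φ e) e')
    (J : Ideal he.Corner) :
    (Ideal.span {1 - e} ⊔ cornerSpan he J).map φ =
      Ideal.span {1 - e'} ⊔ cornerSpan he' (J.map (cornerMap he he' φ hc)) := by
  have h₁ : φ (1 - e) * (1 - e') = φ (1 - e) := by
    rw [map_sub, map_one, mul_sub, mul_one, sub_mul 1, one_mul, h.left, sub_self, sub_zero]
  have h₂ : (1 - e') * φ (1 - e) = 1 - e' := by
    rw [map_sub, map_one, mul_sub, mul_one, sub_mul 1, one_mul, h.right, sub_self, sub_zero]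
  have hval : ∀ x : he.Corner, (cornerMap he he' φ hc x).1 = φ x.1 * e' := fun x => by
    rw [cornerMap_val, ← corner_left he x, map_mul, ← mul_assoc, h.right]
  have hmem : 1 - e' ∈ (Ideal.span {1 - e} ⊔ cornerSpan he J).map φ := by
    rw [← h₂]
    exact Ideal.mul_mem_left _ _ (Ideal.mem_map_of_mem φ
      (Submodule.mem_sup_left (Ideal.mem_span_singleton_self _)))
  refine le_antisymm ?_ ?_
  · rw [Ideal.map_le_iff_le_comap, sup_le_iff, Ideal.span_singleton_le_iff_mem, cornerSpan_le_iff]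
    constructor
    · rw [Ideal.mem_comap, ← h₁]
      exact Ideal.mul_mem_left _ _ (Submodule.mem_sup_left (Ideal.mem_span_singleton_self _))
    · intro x hx
      have h₃ : φ x.1 = φ x.1 * (1 - e') + (cornerMap he he' φ hc x).1 := by
        rw [hval, mul_sub, mul_one, sub_add_cancel]
      rw [mem_cornerComap, Ideal.mem_comap, h₃]
      exact Submodule.add_mem_sup (Ideal.mul_mem_left _ _ (Ideal.mem_span_singleton_self _))
        (val_mem_cornerSpan (Ideal.mem_map_of_mem _ hx))
  · rw [sup_le_iff, Ideal.span_singleton_le_iff_mem, cornerSpan_le_iff, Ideal.map_le_iff_le_comap]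
    refine ⟨hmem, fun x hx => ?_⟩
    rw [Ideal.mem_comap, mem_cornerComap, hval]
    exact mul_idempotent_mem hmem
      (Ideal.mem_map_of_mem φ (Submodule.mem_sup_right (val_mem_cornerSpan hx)))

/-- Intersections need not commute with base change, but spans do, and for a full idempotent the
intersection with the corner is inverse to the span. -/
theorem cornerComap_map_of_le (h : LeftAssociated (φ e) e') (hc : CornerCompatible (φ e) e')
    (hf : IsFull e) {K : Ideal B} (hK : K ≤ Ideal.span {e}) :
    cornerComap he' (K.map φ) = (cornerComap he K).map (cornerMap he he' φ hc) := by
  conv_lhs => rw [← cornerSpan_cornerComap (he := he) hf hK]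
  rw [map_cornerSpan h hc, cornerComap_cornerSpan]

theorem cornerComap_map_of_mem (h : RightAssociated (φ e) e') (hc : CornerCompatible (φ e) e')
    (hf : IsFull e) {K : Ideal B} (hK : 1 - e ∈ K) :
    cornerComap he' (K.map φ) = (cornerComap he K).map (cornerMap he he' φ hc) := by
  conv_lhs => rw [← sup_cornerSpan_cornerComap (he := he) hf hK]
  rw [map_sup_cornerSpan h hc, cornerComap_sup_cornerSpan]

end CornerIdealMap

/-! ### Flags -/

section Flag

variable {R : Type u} [CommRing R] {B : Type u} [Ring B] [Algebra R B] {e : B}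
  {n r : ℕ} {i : Fin r → ℕ} {s : Fin r}

/-- This puts the ranks in the form `d * c` and `n * c + f`, with `c = d - a` and `f = n ^ 2 - n *
d`, required by `IsSplitIdempotent.isLocallyFreeOfRank_iff_of_le`. -/
theorem lower_rank {n d a : ℕ} (had : a ≤ d) (hdn : d ≤ n) :
    d ^ 2 - d * a = d * (d - a) ∧ n ^ 2 - n * a = n * (d - a) + (n ^ 2 - n * d) := by
  obtain ⟨x, rfl⟩ := Nat.exists_eq_add_of_le had
  obtain ⟨y, rfl⟩ := Nat.exists_eq_add_of_le hdn
  have h₁ : ∀ p q : ℕ, (p + q) ^ 2 - (p + q) * p = (p + q) * q := fun p q => by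
    rw [sq, ← Nat.mul_sub, Nat.add_sub_cancel_left]
  refine ⟨by rw [h₁, Nat.add_sub_cancel_left], ?_⟩
  rw [h₁, add_assoc a x y, h₁, Nat.add_sub_cancel_left, Nat.mul_add]

theorem upper_rank {n d a : ℕ} (hda : d ≤ a) :
    (n - d) ^ 2 - (n - d) * (a - d) = (n - d) * (n - a) ∧ n ^ 2 - n * a = n * (n - a) := by
  rw [sq, sq, ← Nat.mul_sub, ← Nat.mul_sub, Nat.sub_sub_sub_cancel_right hda]
  exact ⟨rfl, rfl⟩

/-- The idempotent `e` of `B` has rank `d` and its complement rank `n - d` étale locally, where `B`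
is isomorphic to the algebra of `n × n` matrices, and `B / B e` is locally free of rank
`n² - n d`. -/
structure FlagIdempotent (R : Type u) [CommRing R] {B : Type u} [Ring B] [Algebra R B]
    (n d : ℕ) (e : B) : Prop where
  idem : IsIdempotentElem e
  split : IsSplitIdempotent R n d e
  split' : IsSplitIdempotent R n (n - d) (1 - e)
  locallyFree : IsLocallyFreeOfRank R (B ⧸ Ideal.span {e}) (n ^ 2 - n * d)

variable (he : FlagIdempotent R n (i s) e) (hi : StrictMono i) (hi₁ : ∀ j, 1 ≤ i j)
  (hin : ∀ j, i j ≤ n)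

include hi hi₁ hin in
theorem FlagIdempotent.lower_iff {j : Fin r} (hj : j < s) {K : Ideal B}
    (hK : K ≤ Ideal.span {e}) :
    IsLocallyFreeOfRank R (he.idem.Corner ⧸ cornerComap he.idem K) (i s ^ 2 - i s * i j) ↔
      IsLocallyFreeOfRank R (B ⧸ K) (n ^ 2 - n * i j) := by
  obtain ⟨h₁, h₂⟩ := lower_rank (hi hj).le (hin s)
  rw [h₁, h₂]
  exact he.split.isLocallyFreeOfRank_iff_of_le ((hi₁ s).trans (hin s)) (hi₁ s) he.locallyFree hK _

include hi hi₁ hin in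
theorem FlagIdempotent.upper_iff {j : Fin r} (hj : s < j) {K : Ideal B}
    (hK : Ideal.span {e} ≤ K) :
    IsLocallyFreeOfRank R (he.idem.one_sub.Corner ⧸ cornerComap he.idem.one_sub K)
      ((n - i s) ^ 2 - (n - i s) * (i j - i s)) ↔
      IsLocallyFreeOfRank R (B ⧸ K) (n ^ 2 - n * i j) := by
  obtain ⟨h₁, h₂⟩ := upper_rank (hi hj).le (n := n)
  rw [h₁, h₂]
  have := hi hj
  have := hin j
  refine he.split'.isLocallyFreeOfRank_iff ((hi₁ s).trans (hin s)) (by omega) ?_ _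
  rw [sub_sub_cancel]
  exact hK (Ideal.mem_span_singleton_self e)

/-- The lower and upper parts of a flag with `s`-th step `B e`, as flags of the corners. -/
def FlagIdempotent.restrict (F : { F : FlagSet R B n i // F.1 s = Ideal.span {e} }) :
    FlagSet R he.idem.Corner (i s) (fun j : Set.Iio s => i j) ×
      FlagSet R he.idem.one_sub.Corner (n - i s) (fun j : Set.Ioi s => i j - i s) :=
  ⟨⟨fun j => cornerComap he.idem (F.1.1 j), fun _ _ h => cornerComap_mono (F.1.2.1 h),
    fun j => (he.lower_iff hi hi₁ hin j.2 ((F.1.2.1 (le_of_lt j.2)).trans F.2.le)).2 (F.1.2.2 j)⟩,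
  ⟨fun j => cornerComap he.idem.one_sub (F.1.1 j), fun _ _ h => cornerComap_mono (F.1.2.1 h),
    fun j => (he.upper_iff hi hi₁ hin j.2 (F.2.ge.trans (F.1.2.1 (le_of_lt j.2)))).2 (F.1.2.2 j)⟩⟩

include he in
theorem FlagIdempotent.full (hd : 1 ≤ i s) : IsFull e := he.split.exists_sum_eq_one hd

include he in
theorem FlagIdempotent.full' (hd : i s < n) : IsFull (1 - e) :=
  he.split'.exists_sum_eq_one (by omega)

/-- Each step of the flag other than the `s`-th is recovered from its intersection with a corner: as
a span below `s`, and as the sum of `B e` and a span above `s`. -/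
theorem FlagIdempotent.restrict_bijective :
    Function.Bijective (he.restrict hi hi₁ hin) := by
  -- When `i s = n` the complement has rank `0` and fullness is not available, but then there is no
  -- step above `s`.
  have hfull' : ∀ {j}, s < j → IsFull (1 - e) := fun hj => he.full' ((hi hj).trans_le (hin _))
  constructor
  · intro F F' h
    refine Subtype.ext (Subtype.ext (funext fun j => ?_))
    rcases lt_trichotomy j s with hj | rfl | hj
    · have h₁ : cornerComap he.idem (F.1.1 j) = cornerComap he.idem (F'.1.1 j) :=
        congrFun (congrArg (fun z => z.1.1) h) ⟨j, hj⟩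
      rw [← cornerSpan_cornerComap (he := he.idem) (he.full (hi₁ s))
          ((F.1.2.1 hj.le).trans F.2.le), h₁,
        cornerSpan_cornerComap (he := he.idem) (he.full (hi₁ s))
          ((F'.1.2.1 hj.le).trans F'.2.le)]
    · rw [F.2, F'.2]
    · have h₁ : cornerComap he.idem.one_sub (F.1.1 j) = cornerComap he.idem.one_sub (F'.1.1 j) :=
        congrFun (congrArg (fun z => z.2.1) h) ⟨j, hj⟩
      have hmem : ∀ F : { F : FlagSet R B n i // F.1 s = Ideal.span {e} },
          1 - (1 - e) ∈ F.1.1 j := fun F => by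
        rw [sub_sub_cancel]
        exact F.1.2.1 hj.le (F.2.ge (Ideal.mem_span_singleton_self e))
      rw [← sup_cornerSpan_cornerComap (he := he.idem.one_sub) (hfull' hj) (hmem F), h₁,
        sup_cornerSpan_cornerComap (he := he.idem.one_sub) (hfull' hj) (hmem F')]
  · rintro ⟨J, J'⟩
    let F : Fin r → Ideal B := fun j =>
      if hj : j < s then cornerSpan he.idem (J.1 ⟨j, hj⟩)
      else if hj : s < j then
        Ideal.span {1 - (1 - e)} ⊔ cornerSpan he.idem.one_sub (J'.1 ⟨j, hj⟩)
      else Ideal.span {e}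
    have hlt : ∀ {j} (hj : j < s), F j = cornerSpan he.idem (J.1 ⟨j, hj⟩) := fun hj => dif_pos hj
    have hgt : ∀ {j} (hj : s < j), F j =
        Ideal.span {1 - (1 - e)} ⊔ cornerSpan he.idem.one_sub (J'.1 ⟨j, hj⟩) := fun hj =>
      (dif_neg hj.not_gt).trans (dif_pos hj)
    have hs : F s = Ideal.span {e} := (dif_neg (lt_irrefl s)).trans (dif_neg (lt_irrefl s))
    have hle : ∀ {j}, j ≤ s → F j ≤ Ideal.span {e} := fun {j} hj => by
      rcases hj.lt_or_eq with hj | rfl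
      · rw [hlt hj]
        exact cornerSpan_le _
      · exact hs.le
    have hge : ∀ {j}, s ≤ j → Ideal.span {e} ≤ F j := fun {j} hj => by
      rcases hj.lt_or_eq with hj | rfl
      · rw [hgt hj, sub_sub_cancel]
        exact le_sup_left
      · exact hs.ge
    -- Comparisons across `s` pass through `B e`.
    have hmono : Monotone F := by
      intro j j' hjj
      rcases lt_or_ge j' s with h' | h'
      · rw [hlt (hjj.trans_lt h'), hlt h']
        exact cornerSpan_mono (J.2.1 hjj)
      · rcases lt_or_ge s j with h | h
        · rw [hgt h, hgt (h.trans_le hjj)]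
          exact sup_le_sup_left (cornerSpan_mono (J'.2.1 hjj)) _
        · exact (hle h).trans (hge h')
    have hc : ∀ {j} (hj : j < s), cornerComap he.idem (F j) = J.1 ⟨j, hj⟩ := fun hj => by
      rw [hlt hj, cornerComap_cornerSpan]
    have hc' : ∀ {j} (hj : s < j), cornerComap he.idem.one_sub (F j) = J'.1 ⟨j, hj⟩ := fun hj => by
      rw [hgt hj, cornerComap_sup_cornerSpan]
    refine ⟨⟨⟨F, hmono, fun j => ?_⟩, hs⟩, Prod.ext (Subtype.ext (funext fun j => hc j.2))
      (Subtype.ext (funext fun j => hc' j.2))⟩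
    rcases lt_trichotomy j s with hj | rfl | hj
    · rw [← he.lower_iff hi hi₁ hin hj (hle hj.le), hc hj]
      exact J.2.2 ⟨j, hj⟩
    · rw [hs]
      exact he.locallyFree
    · rw [← he.upper_iff hi hi₁ hin hj (hge hj.le), hc' hj]
      exact J'.2.2 ⟨j, hj⟩

end Flag

/-! ### Flag idempotents in central simple algebras -/

section Existence

variable {k : Type u} [Field k] {A : Type u} [Ring A] [Algebra k A] {n d : ℕ}

theorem IsAzumayaOfDegree.isLocallyFreeOfRank (hA : IsAzumayaOfDegree k A n) (R : Type u)
    [CommRing R] [Algebra k R] : IsLocallyFreeOfRank R (R ⊗[k] A) (n ^ 2) := by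
  obtain ⟨hn, ⟨E⟩⟩ := hA
  have := finite_of_splitting E hn
  refine ⟨inferInstance, inferInstance, fun p => ?_⟩
  have : Nontrivial R := p.nontrivial
  rw [Module.rankAtStalk_eq_finrank_of_free, Pi.natCast_apply, Module.finrank_baseChange,
    finrank_of_splitting E, Nat.cast_id]

/-- The left ideals with locally free quotients of a base change of a central simple algebra are
generated by idempotents of constant rank. -/
theorem IsAzumayaOfDegree.exists_flagIdempotent (hA : IsAzumayaOfDegree k A n) (hd : d ≤ n)
    {R : Type u} [CommRing R] [Algebra k R] (I : Ideal (R ⊗[k] A))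
    (hI : IsLocallyFreeOfRank R ((R ⊗[k] A) ⧸ I) (n ^ 2 - n * d)) :
    ∃ e, FlagIdempotent R n d e ∧ I = Ideal.span {e} := by
  obtain ⟨e, he, rfl⟩ := hA.exists_idempotent I hI.2.1
  have hnd : n ^ 2 - n * d = n * (n - d) := by rw [sq, ← Nat.mul_sub]
  refine ⟨e, ⟨he, hA.isSplitIdempotent he ?_, hA.isSplitIdempotent he.one_sub ?_, hI⟩, rfl⟩
  · rw [← hI.prod_iff]
    have h₁ : n * d + (n ^ 2 - n * d) = n ^ 2 := by
      rw [hnd, ← Nat.mul_add, Nat.add_sub_of_le hd, sq]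
    rw [h₁]
    -- The decomposition of `B / I` for `I = ⊥` reads `B ≃ B / B (1 - e) × B / B e`; subtracting
    -- ranks from `n ^ 2` gives `n * d` for the first factor.
    have h₂ := (hA.isLocallyFreeOfRank R).of_equiv
      ((Submodule.quotEquivOfEqBot (⊥ : Ideal (R ⊗[k] A)) rfl).restrictScalars R).symm
    have h₃ := h₂.of_equiv (quotientEquivProd R he bot_le)
    rwa [sup_bot_eq] at h₃
  · rw [sub_sub_cancel, ← hnd]
    exact hI

end Existence

/-! ### Corners as subquotients -/

section Subquotient

variable {R : Type u} [CommRing R] {B : Type u} [Ring B] [Algebra R B] {e a : B}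

theorem mem_idealAlg_span (he : IsIdempotentElem e) :
    a ∈ idealAlg R (Ideal.span {e}) ↔ a * e = a :=
  ⟨fun h => mul_idempotent_of_mem he h,
    fun h => h ▸ Ideal.mul_mem_left _ a (Ideal.mem_span_singleton_self e)⟩

theorem mem_annAlg_span : a ∈ annAlg R (Ideal.span {e}) ↔ e * a = 0 := by
  refine ⟨fun h => h e (Ideal.mem_span_singleton_self e), fun h y hy => ?_⟩
  obtain ⟨b, rfl⟩ := Ideal.mem_span_singleton'.1 hy
  rw [mul_assoc, h, mul_zero]

/-- An element with `e a = 0` and `a = a e` is itself a product of `a ∈ I°` and `e ∈ I`, so `I° I =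
(1 - e) B e`. -/
theorem mem_annMul_span (he : IsIdempotentElem e) :
    a ∈ annMul R (Ideal.span {e}) ↔ e * a = 0 ∧ a * e = a := by
  constructor
  · intro h
    refine Submodule.mul_induction_on h (fun x hx y hy => ?_) fun x y hx hy => ?_
    · rw [← mul_assoc, (mem_annAlg_span (R := R)).1 hx, zero_mul, mul_assoc,
        (mem_idealAlg_span (R := R) he).1 hy]
      exact ⟨rfl, rfl⟩
    · rw [mul_add, add_mul, hx.1, hx.2, hy.1, hy.2, add_zero]
      exact ⟨rfl, rfl⟩
  · rintro ⟨h₁, h₂⟩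
    rw [← h₂]
    exact Submodule.mul_mem_mul ((mem_annAlg_span (R := R)).2 h₁)
      ((mem_idealAlg_span (R := R) he).2 he.eq)

variable (R) in
/-- The projection of the left ideal `B e` onto the corner `e B e`. -/
def idealToCorner (he : IsIdempotentElem e) :
    idealAlg R (Ideal.span {e}) →ₙₐ[R] he.Corner where
  toFun a := cornerMk he a.1
  map_smul' r a := (cornerProj R he).map_smul r a.1
  map_zero' := (cornerProj R he).map_zero
  map_add' a b := (cornerProj R he).map_add a.1 b.1
  map_mul' a b := Subtype.ext (by
    change e * (a.1 * b.1) * e = e * a.1 * e * (e * b.1 * e)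
    rw [mul_assoc e a.1 e, (mem_idealAlg_span he).1 a.2]
    nth_rewrite 1 [← (mem_idealAlg_span he).1 a.2]
    simp only [mul_assoc])

variable (R) in
/-- The projection of the right ideal `(1 - e) B` onto the corner `(1 - e) B (1 - e)`. -/
def annToCorner (he : IsIdempotentElem e) :
    annAlg R (Ideal.span {e}) →ₙₐ[R] he.one_sub.Corner where
  toFun a := cornerMk he.one_sub a.1
  map_smul' r a := (cornerProj R he.one_sub).map_smul r a.1
  map_zero' := (cornerProj R he.one_sub).map_zero
  map_add' a b := (cornerProj R he.one_sub).map_add a.1 b.1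
  map_mul' a b := Subtype.ext (by
    have h : (1 - e) * b.1 = b.1 := by rw [sub_mul, one_mul, mem_annAlg_span.1 b.2, sub_zero]
    change (1 - e) * (a.1 * b.1) * (1 - e) =
      (1 - e) * a.1 * (1 - e) * ((1 - e) * b.1 * (1 - e))
    rw [h]
    nth_rewrite 1 [← h]
    simp only [mul_assoc])

end Subquotient

section IdempotentFamily

variable {C : Type w} [Category.{v} C] {O : C ⥤ CommRingCat.{u}}

/-- A family of idempotents generating a family of left ideals stable under base change. -/
structure IdempotentFamily (E : QCohAlg O) (e : ∀ c, E.obj c) : Prop where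
  idem : ∀ c, IsIdempotentElem (e c)
  assoc : ∀ {c d} (f : c ⟶ d), LeftAssociated (E.map f (e c)) (e d)

variable {E : QCohAlg O} {e : ∀ c, E.obj c} (h : IdempotentFamily E e)

namespace IdempotentFamily

include h in
theorem one_sub_assoc {c d} (f : c ⟶ d) :
    RightAssociated (E.map f (1 - e c)) (1 - e d) := by
  rw [map_sub, map_one]
  exact (h.assoc f).one_sub

include h in
theorem compatible {c d} (f : c ⟶ d) : CornerCompatible (E.map f (e c)) (e d) :=
  (h.assoc f).cornerCompatible ((h.idem c).map (E.map f)) (h.idem d)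

include h in
theorem one_sub_compatible {c d} (f : c ⟶ d) :
    CornerCompatible (E.map f (1 - e c)) (1 - e d) :=
  (h.one_sub_assoc f).cornerCompatible ((h.idem c).one_sub.map (E.map f)) (h.idem d).one_sub

/-- The algebra of the corners `e E e`. -/
def lowerAlg : QCohAlg O :=
  cornerAlg E e h.idem h.compatible fun {c d d'} f g => by
    have hfg : E.map (f ≫ g) (e c) * E.map g (e d) = E.map (f ≫ g) (e c) := by
      rw [E.map_comp, ← map_mul, (h.assoc f).left]
    rw [hfg, (h.assoc g).right, (h.assoc (f ≫ g)).right]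
    exact ⟨rfl, rfl⟩

/-- The algebra of the corners `(1 - e) E (1 - e)`. -/
def upperAlg : QCohAlg O :=
  cornerAlg E (fun c => 1 - e c) (fun c => (h.idem c).one_sub) h.one_sub_compatible
    fun {c d d'} f g => by
      have hfg : E.map (f ≫ g) (1 - e c) * E.map g (1 - e d) = E.map g (1 - e d) := by
        rw [E.map_comp, ← map_mul, (h.one_sub_assoc f).left]
      have hgf : E.map g (1 - e d) * E.map (f ≫ g) (1 - e c) = E.map (f ≫ g) (1 - e c) := by
        rw [E.map_comp, ← map_mul, (h.one_sub_assoc f).right]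
      rw [hfg, mul_assoc, hgf, (h.one_sub_assoc g).left, (h.one_sub_assoc (f ≫ g)).left]
      exact ⟨rfl, rfl⟩

/-- On `I = B e` the compression `a ↦ e a e` equals `a ↦ e a`, whose kernel is `(1 - e) B e`; left
association makes it commute with base change. -/
theorem lowerAlg_isSubquotient :
    h.lowerAlg.IsSubquotient E (fun c => idealAlg _ (Ideal.span {e c}))
      (fun c => annMul _ (Ideal.span {e c})) := by
  refine ⟨fun c => idealToCorner _ (h.idem c), fun c x => ?_, fun c a => ?_, fun {c d} f a => ?_⟩
  · exact ⟨⟨x.1, (mem_idealAlg_span (h.idem c)).2 (corner_right (h.idem c) x)⟩,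
      cornerMk_val_self (h.idem c) x⟩
  · have ha := (mem_idealAlg_span (h.idem c)).1 a.2
    rw [mem_annMul_span (h.idem c)]
    refine Subtype.ext_iff.trans ?_
    change e c * a.1 * e c = 0 ↔ _
    rw [mul_assoc, ha]
    exact (and_iff_left rfl).symm
  · have ha := (mem_idealAlg_span (h.idem c)).1 a.2
    have hφ : E.map f a.1 * E.map f (e c) = E.map f a.1 := by rw [← map_mul, ha]
    refine ⟨⟨E.map f a.1, (mem_idealAlg_span (h.idem d)).2 ?_⟩, rfl, Subtype.ext ?_⟩
    · rw [← hφ, mul_assoc, (h.assoc f).left]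
    · change e d * E.map f a.1 * e d = e d * E.map f (e c * a.1 * e c) * e d
      rw [mul_assoc (e c), ha, map_mul, ← mul_assoc, (h.assoc f).right]

theorem upperAlg_isSubquotient :
    h.upperAlg.IsSubquotient E (fun c => annAlg _ (Ideal.span {e c}))
      (fun c => annMul _ (Ideal.span {e c})) := by
  have hann : ∀ {c} (a : annAlg (O.obj c) (Ideal.span {e c})), (1 - e c) * a.1 = a.1 :=
    fun a => by rw [sub_mul, one_mul, mem_annAlg_span.1 a.2, sub_zero]
  refine ⟨fun c => annToCorner _ (h.idem c), fun c x => ?_, fun c a => ?_, fun {c d} f a => ?_⟩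
  · refine ⟨⟨x.1, mem_annAlg_span.2 ?_⟩, cornerMk_val_self (h.idem c).one_sub x⟩
    rw [← corner_left (h.idem c).one_sub x, ← mul_assoc, mul_sub, mul_one, (h.idem c).eq, sub_self,
      zero_mul]
  · rw [mem_annMul_span (h.idem c)]
    refine Subtype.ext_iff.trans ?_
    change (1 - e c) * a.1 * (1 - e c) = 0 ↔ _
    rw [hann, mul_sub, mul_one, sub_eq_zero, eq_comm]
    exact (and_iff_right (mem_annAlg_span.1 a.2)).symm
  · refine ⟨⟨E.map f a.1, mem_annAlg_span.2 ?_⟩, rfl, Subtype.ext ?_⟩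
    · rw [← (h.assoc f).right, mul_assoc, ← map_mul, mem_annAlg_span.1 a.2, map_zero, mul_zero]
    · change (1 - e d) * E.map f a.1 * (1 - e d) =
        (1 - e d) * E.map f ((1 - e c) * a.1 * (1 - e c)) * (1 - e d)
      rw [hann, map_mul, mul_assoc, mul_assoc, mul_assoc, (h.one_sub_assoc f).left]

end IdempotentFamily

end IdempotentFamily

/-! ### Restriction of flags to corners and base change -/

section RestrictFlag

variable {C : Type w} [Category.{v} C] {O : C ⥤ CommRingCat.{u}} {E : QCohAlg O}
  {e : ∀ c, E.obj c} (h : IdempotentFamily E e) {n r : ℕ} {i : Fin r → ℕ} {s : Fin r}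
  (he : ∀ c, FlagIdempotent (O.obj c) n (i s) (e c))
  (hi : StrictMono i) (hi₁ : ∀ j, 1 ≤ i j) (hin : ∀ j, i j ≤ n)

/-- Naturality of the bijection on flags, although the idempotents at `c` and `d` are chosen
independently. -/
theorem restrict_map {c d : C} (f : c ⟶ d)
    (F : { F : FlagSet (O.obj c) (E.obj c) n i // F.1 s = Ideal.span {e c} })
    (F' : { F : FlagSet (O.obj d) (E.obj d) n i // F.1 s = Ideal.span {e d} })
    (hF : F'.1 = (flagFunctor E n i).map f F.1) :
    (he d).restrict hi hi₁ hin F' =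
      ((flagFunctor h.lowerAlg (i s) fun j : Set.Iio s => i j).map f
          ((he c).restrict hi hi₁ hin F).1,
        (flagFunctor h.upperAlg (n - i s) fun j : Set.Ioi s => i j - i s).map f
          ((he c).restrict hi hi₁ hin F).2) := by
  have hF' : ∀ j, F'.1.1 j = (F.1.1 j).map (E.map f) := fun j => by rw [hF]; rfl
  refine Prod.ext (Subtype.ext (funext fun j => ?_)) (Subtype.ext (funext fun j => ?_))
  · change cornerComap _ (F'.1.1 j) = _
    rw [hF']
    exact cornerComap_map_of_le (h.assoc f) (h.compatible f) ((he c).full (hi₁ s))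
      ((F.1.2.1 (le_of_lt j.2)).trans F.2.le)
  · change cornerComap _ (F'.1.1 j) = _
    rw [hF']
    refine cornerComap_map_of_mem (h.one_sub_assoc f) (h.one_sub_compatible f)
      ((he c).full' ((hi j.2).trans_le (hin _))) ?_
    rw [sub_sub_cancel]
    exact F.1.2.1 (le_of_lt j.2) (F.2.ge (Ideal.mem_span_singleton_self _))

end RestrictFlag

/-! ### The universal left ideal and the final assembly -/

section Scheme

variable {k : Type u} [Field k] {A : Type u} [Ring A] [Algebra k A] {n : ℕ}

theorem univIdeal_map {S : Over (Spec (.of k))} {d : ℕ}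
    (eS : Represents S (flagFunctorOver k A n fun _ : Unit => d)) {x x' : (points S).Elements}
    (f : x ⟶ x') : (univIdeal eS x).map ((constAlgOn A S).map f) = univIdeal eS x' := by
  have h₁ := NatTrans.naturality_apply eS.hom f.1 x.2
  have h₂ : (points S).map f.1 x.2 = x'.2 := f.2
  rw [h₂] at h₁
  exact (congrFun (congrArg Subtype.val h₁) ()).symm

/-- The universal left ideal is generated locally by idempotents. -/
theorem exists_idempotentFamily (hA : IsAzumayaOfDegree k A n) {S : Over (Spec (.of k))} {d : ℕ}
    (hd : d ≤ n) (eS : Represents S (flagFunctorOver k A n fun _ : Unit => d)) :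
    ∃ e : ∀ x, (constAlgOn A S).obj x, IdempotentFamily (constAlgOn A S) e ∧
      (∀ x, FlagIdempotent ((structureRing S).obj x) n d (e x)) ∧
      univIdeal eS = fun x => Ideal.span {e x} := by
  -- The choices at different points are unrelated; the left ideals they generate correspond under
  -- base change, which is all that `IdempotentFamily` asks.
  choose e he hIe using fun x : (points S).Elements =>
    hA.exists_flagIdempotent hd (univIdeal eS x) ((eS.hom.app x.1 x.2).2.2 ())
  refine ⟨e, ⟨fun x => (he x).idem, fun {x x'} f => ?_⟩, he, funext hIe⟩
  refine leftAssociated_of_span_eq ((he x).idem.map _) (he x').idem ?_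
  have h := univIdeal_map eS f
  rw [hIe x, hIe x'] at h
  exact ((Ideal.map_span _ _).trans (congrArg Ideal.span Set.image_singleton)).symm.trans h

/-- The forgetful map from flags to one of their steps. -/
def flagStep {r : ℕ} (i : Fin r → ℕ) (s : Fin r) :
    flagFunctorOver k A n i ⟶ flagFunctorOver k A n fun _ : Unit => i s where
  app _ := ↾fun F => ⟨fun _ => F.1 s, fun _ _ _ => le_rfl, fun _ => F.2.2 s⟩
  naturality _ _ _ := rfl

end Scheme

end TwistedFlag

end

theorem mainTheorem2 {k : Type u} [Field k] {A : Type u} [Ring A] [Algebra k A]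
    {n : ℕ} (hA : IsAzumayaOfDegree k A n)
    {r : ℕ} (i : Fin r → ℕ) (hi : StrictMono i) (hi₁ : ∀ j, 1 ≤ i j) (hin : ∀ j, i j ≤ n)
    (s : Fin r)
    (S : Over (Spec (.of k))) (eS : Represents S (flagFunctorOver k A n fun _ : Unit => i s))
    (X : Over (Spec (.of k))) (eX : Represents X (flagFunctorOver k A n i)) :
    ∃ Bm Bp : QCohAlg (structureRing S),
      Bm.IsAzumaya (i s) ∧ Bp.IsAzumaya (n - i s) ∧
      Bm.IsSubquotient (constAlgOn A S)
        (fun x => idealAlg _ (univIdeal eS x)) (fun x => annMul _ (univIdeal eS x)) ∧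
      Bp.IsSubquotient (constAlgOn A S)
        (fun x => annAlg _ (univIdeal eS x)) (fun x => annMul _ (univIdeal eS x)) ∧
      ∃ p : X ⟶ S,
        (∀ (R : CommAlgCat.{u} k) (x : (points X).obj R),
          (eS.hom.app R (x ≫ p)).1 () = (eX.hom.app R x).1 s) ∧
        ∀ (Ym Yp : Over (Spec (.of k))) (gm : Ym ⟶ S) (gp : Yp ⟶ S)
          (_ : RepresentsOver gm (flagFunctor Bm (i s) fun j : Set.Iio s => i j))
          (_ : RepresentsOver gp (flagFunctor Bp (n - i s) fun j : Set.Ioi s => i j - i s)),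
          ∃ φ : X ≅ pullback gm gp, φ.hom ≫ pullback.fst gm gp ≫ gm = p := by
  obtain ⟨e, h, he, hIe⟩ := exists_idempotentFamily hA (hin s) eS
  obtain ⟨p, hp⟩ := exists_hom_of_points (eX.hom ≫ flagStep i s ≫ eS.inv)
  have hp' : ∀ (R : CommAlgCat.{u} k) (x : (points X).obj R),
      eS.hom.app R (x ≫ p) = (flagStep i s).app R (eX.hom.app R x) := fun R x =>
    (congrArg (eS.hom.app R) (hp R x)).trans (Iso.inv_hom_id_apply (eS.app R) _)
  refine ⟨h.lowerAlg, h.upperAlg, fun x => (he x).split.exists_corner_algEquiv (he x).idem,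
    fun x => (he x).split'.exists_corner_algEquiv (he x).idem.one_sub,
    by rw [hIe]; exact h.lowerAlg_isSubquotient, by rw [hIe]; exact h.upperAlg_isSubquotient, p,
    fun R x => congrArg (fun F => F.1 ()) (hp' R x), fun Ym Yp gm gp rm rp => ?_⟩
  -- The points of `X` above `x` are exactly the flags whose `s`-th step is the left ideal generated
  -- by `e x`.
  have hx : ∀ (x : (points S).Elements) (y : (points X).obj x.1),
      y ≫ p = x.2 ↔ ((eX.app x.1).toEquiv y).1 s = Ideal.span {e x} := fun x y => by
    have h₁ : (eS.hom.app x.1 x.2).1 () = Ideal.span {e x} := congrFun hIe x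
    rw [← h₁]
    constructor
    · intro hy
      rw [← hy]
      exact (congrArg (fun F => F.1 ()) (hp' x.1 y)).symm
    · intro hy
      refine (eS.app x.1).toEquiv.injective ?_
      refine (hp' x.1 y).trans (Subtype.ext (funext fun _ => hy))
  let T₁ : ∀ x : (points S).Elements, (relPoints p).obj x ≃
      { F : FlagSet ((structureRing S).obj x) ((constAlgOn A S).obj x) n i //
        F.1 s = Ideal.span {e x} } := fun x => (eX.app x.1).toEquiv.subtypeEquiv (hx x)
  let T₂ := fun x => Equiv.ofBijective _ ((he x).restrict_bijective hi hi₁ hin)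
  -- Points of `X` above `x` become flags through `B e`, then pairs of flags in the two corners,
  -- then pairs of points of `Ym` and `Yp` above `x`.
  refine exists_iso_pullback p gm gp (fun x => ((T₁ x).trans (T₂ x)).trans
    (Equiv.prodCongr (rm.app x).toEquiv.symm (rp.app x).toEquiv.symm)) fun {x x'} f y => ?_
  have h₀ : eX.hom.app x'.1 ((points X).map f.1 y.1) =
      (flagFunctorOver k A n i).map f.1 (eX.hom.app x.1 y.1) :=
    NatTrans.naturality_apply eX.hom f.1 y.1
  have h₁ : (T₁ x' ((relPoints p).map f y)).1 =
      (flagFunctor (constAlgOn A S) n i).map f (T₁ x y).1 := h₀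
  have h₂ := restrict_map h he hi hi₁ hin f (T₁ x y) (T₁ x' ((relPoints p).map f y)) h₁
  refine Prod.ext ?_ ?_
  · exact (congrArg (fun z => rm.inv.app x' z.1) h₂).trans (NatTrans.naturality_apply rm.inv f _)
  · exact (congrArg (fun z => rp.inv.app x' z.2) h₂).trans (NatTrans.naturality_apply rp.inv f _)
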